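/- Let $\mathcal I$ be a countable, additively cancellative commutative semiring with a non-trivial parity function, i.e. a non-zero monoid homomorphism $p:(\mathcal I,+)\to\mathbb Z_2$. Let $V=\bigoplus_i V_i$ be a finite-dimensional real $\mathcal I$-graded vector space with $V_0=0$ and $\dim V_i=m_i$, and let $\mathrm S(V)=\bigoplus_n \mathrm S^n(V)$ be its graded symmetric algebra, in which $vw=(-1)^{p(ij)}wv$ for $v\in V_i$, $w\in V_j$. Put $\overline{\mathrm S(V)}=\prod_n\mathrm S^n(V)$. An $\mathcal I$-graded domain $\mathcal U=(U,\mathcal O)$ of dimension $n|(m_i)$ is an open set $U\subseteq\mathbb R^n$ with the sheaf $\mathcal O(W)=\prod_n C^\infty(W)\otimes \mathrm S^n(V)$ of smooth $\overline{\mathrm S(V)}$-valued functions; $\mathcal O(W)_i=\prod_n C^\infty(W)\otimes \mathrm S^n(V)_i$, and $\epsilon:\mathcal O(W)\to C^\infty(W)$ is the projection to $n=0$. A morphism $\varphi=(\tilde\varphi,\varphi^*):\mathcal U_1\to\mathcal U_2$ is a continuous map $\tilde\varphi:U_1\to U_2$ with a family, compatible with restrictions, of $\mathbb R$-algebra homomorphisms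 $\varphi^*:\mathcal O_2(W)\to\mathcal O_1(\tilde\varphi^{-1}(W))$, $W\subseteq U_2$ open, which map $\mathcal O_2(W)_i$ into $\mathcal O_1(\tilde\varphi^{-1}(W))_i$ for every $i$ and induce local maps on stalks. A coordinate system of $\mathcal U$ consists of $x^\mu\in\mathcal O(U)_0$ ($1\le\mu\le n$) such that $\tilde x=(\epsilon(x^1),\dots,\epsilon(x^n))$ is a diffeomorphism of $U$ onto an open subset of $\mathbb R^n$, and of $\theta_{i,a}\in\mathcal O(U)_i$ ($i\ne0$, $1\le a\le m_i$) such that the $C^\infty(U)$-subalgebra of $\mathcal O(U)$ that they generate is dense in the $(\ker\epsilon)$-adic topology. Fix an ordering of the index pairs $(i,a)$; let $\theta^\beta$ denote the correspondingly ordered monomials, where $\beta_{i,a}\in\mathbb N$, and $\beta_{i,a}\le1$ if $p(i\cdot i)=1$. For $g\in C^\infty(\Omega)$, $\Omega\subseteq\mathbb R^n$ open, and $z^1,\dots,z^n\in\mathcal O(W)_0$ such that $\epsilon(z)=(\epsilon(z^1),\dots,\epsilon(z^n))$ maps $W$ into $\Omega$, put (Grassmann analytic continuation) $$g(z)=\sum_{\alpha\in\mathbb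 N^n}\frac1{\alpha!}\,(\partial^\alpha g)(\epsilon(z))\,(z^1-\epsilon(z^1))^{\alpha_1}\cdots(z^n-\epsilon(z^n))^{\alpha_n}\in\mathcal O(W)_0 .$$ **Theorem (Global Chart Theorem).** Let $\mathcal U_1,\mathcal U_2$ be $\mathcal I$-graded domains (not necessarily of the same dimension), let $(x^\mu,\theta_{i,a})$ be a coordinate system of $\mathcal U_2$, and let $\Omega=\tilde x(U_2)$. 1. For every morphism $\varphi:\mathcal U_1\to\mathcal U_2$, the elements $y^\mu=\varphi^*x^\mu$ and $\eta_{i,a}=\varphi^*\theta_{i,a}$ satisfy $$y^\mu\in\mathcal O_1(U_1)_0,\qquad \eta_{i,a}\in\mathcal O_1(U_1)_i,\qquad (\epsilon(y^\mu)(q))_\mu\in\Omega\ \text{ for all } q\in U_1.\tag{$*$}$$ 2. Every $f\in\mathcal O_2(U_2)$ can be written as $f=\sum_\beta f_\beta(x)\,\theta^\beta$ with uniquely determined $f_\beta\in C^\infty(\Omega)$. 3. For all $y^\mu,\eta_{i,a}$ satisfying $(*)$ there is exactly one morphism $\varphi:\mathcal U_1\to\mathcal U_2$ with $\varphi^*x^\mu=y^\mu$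 and $\varphi^*\theta_{i,a}=\eta_{i,a}$ for all $\mu,i,a$. It is given by $\varphi^*\big(\sum_\beta f_\beta(x)\,\theta^\beta\big)=\sum_\beta f_\beta(y)\,\eta^\beta$. (All infinite sums are sums of formal power series in which each coefficient receives only finitely many non-zero contributions.) -/

import Mathlib

open scoped ContDiff
open TopologicalSpace

noncomputable section

namespace IGraded

/-! ### Smooth functions on open subsets of `ℝⁿ` -/

/-- Extension by zero of a function on an open set of `ℝⁿ`. -/
def zeroExt {n : ℕ} {W : Opens (Fin n → ℝ)} (f : W → ℝ) : (Fin n → ℝ) → ℝ :=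
  Function.extend Subtype.val f 0

theorem zeroExt_apply {n : ℕ} {W : Opens (Fin n → ℝ)} (f : W → ℝ) (x : W) :
    zeroExt f x = f x := by
  unfold zeroExt
  exact Subtype.val_injective.extend_apply f 0 x

/-- `C^∞(W)`, as an algebra of functions on `W`. -/
def Cinf {n : ℕ} (W : Opens (Fin n → ℝ)) : Subalgebra ℝ (W → ℝ) where
  carrier := {f | ∃ g : (Fin n → ℝ) → ℝ, ContDiffOn ℝ ∞ g W ∧ ∀ x : W, f x = g x}
  mul_mem' := by
    rintro f₁ f₂ ⟨g₁, h₁, e₁⟩ ⟨g₂, h₂, e₂⟩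
    exact ⟨fun x => g₁ x * g₂ x, h₁.mul h₂, fun x => by simp [e₁, e₂]⟩
  add_mem' := by
    rintro f₁ f₂ ⟨g₁, h₁, e₁⟩ ⟨g₂, h₂, e₂⟩
    exact ⟨fun x => g₁ x + g₂ x, h₁.add h₂, fun x => by simp [e₁, e₂]⟩
  algebraMap_mem' := fun r => ⟨fun _ => r, contDiffOn_const, fun _ => rfl⟩

theorem contDiffOn_zeroExt {n : ℕ} {W : Opens (Fin n → ℝ)} (f : Cinf W) :
    ContDiffOn ℝ ∞ (zeroExt f.1) W := by
  obtain ⟨f, g, hg, e⟩ := f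
  refine hg.congr fun x hx => ?_
  exact (zeroExt_apply f ⟨x, hx⟩).trans (e ⟨x, hx⟩)

/-- Restriction of smooth functions. -/
def Cinf.res {n : ℕ} {W' W : Opens (Fin n → ℝ)} (h : W' ≤ W) : Cinf W →ₐ[ℝ] Cinf W' where
  toFun f := ⟨fun x => f.1 ⟨x.1, h x.2⟩, by
    obtain ⟨f, g, hg, e⟩ := f
    exact ⟨g, hg.mono h, fun x => e ⟨x.1, h x.2⟩⟩⟩
  map_one' := rfl
  map_mul' _ _ := rfl
  map_zero' := rfl
  map_add' _ _ := rfl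
  commutes' _ := rfl

/-- The partial derivative `∂_μ : C^∞(W) → C^∞(W)`. -/
def Cinf.pd {n : ℕ} {W : Opens (Fin n → ℝ)} (μ : Fin n) (f : Cinf W) : Cinf W :=
  ⟨fun x => fderiv ℝ (zeroExt f.1) x (Pi.single μ 1),
    fun x => fderiv ℝ (zeroExt f.1) x (Pi.single μ 1),
    ((contDiffOn_zeroExt f).fderiv_of_isOpen W.isOpen (m := ∞) (by simp)).clm_apply
      contDiffOn_const, fun _ => rfl⟩

/-- `∂^α f = ∂_1^{α_1} ⋯ ∂_n^{α_n} f`. -/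
def Cinf.pdMulti {n : ℕ} {W : Opens (Fin n → ℝ)} (α : Fin n → ℕ) (f : Cinf W) : Cinf W :=
  (List.finRange n).foldr (fun μ h => (Cinf.pd μ)^[α μ] h) f

/-- The composite `g(t_1, …, t_n)` of `g ∈ C^∞(V)`, `V ⊆ ℝᵐ`, with a smooth map
`t = (t_1, …, t_m) : W → V`. -/
def Cinf.comp {m n : ℕ} {V : Opens (Fin m → ℝ)} {W : Opens (Fin n → ℝ)} (g : Cinf V)
    (t : Fin m → Cinf W) (ht : ∀ w : W, (fun μ => (t μ).1 w) ∈ V) : Cinf W :=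
  ⟨fun w => g.1 ⟨fun μ => (t μ).1 w, ht w⟩,
    fun w => zeroExt g.1 (fun μ => zeroExt (t μ).1 w), by
      refine (contDiffOn_zeroExt g).comp
        (contDiffOn_pi.2 fun μ => contDiffOn_zeroExt (t μ)) ?_
      intro w hw
      have h := ht ⟨w, hw⟩
      have e : (fun μ => zeroExt (t μ).1 w) = fun μ => (t μ).1 ⟨w, hw⟩ :=
        funext fun μ => zeroExt_apply (t μ).1 ⟨w, hw⟩
      change (fun μ => zeroExt (t μ).1 w) ∈ V
      rw [e]; exact h, by
      intro w
      have e : (fun μ => zeroExt (t μ).1 w) = fun μ => (t μ).1 w :=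
        funext fun μ => zeroExt_apply (t μ).1 w
      change g.1 ⟨fun μ => (t μ).1 w, ht w⟩ = zeroExt g.1 (fun μ => zeroExt (t μ).1 w)
      rw [e]
      exact (zeroExt_apply g.1 ⟨_, ht w⟩).symm⟩

/-! ### Formal power series in graded commuting variables

`I` is the grading semiring, `p` its parity function, and `θ_a`, `a : Fin N`, are variables of
degree `deg a`, subject to `θ_a θ_b = (-1)^{p(deg a · deg b)} θ_b θ_a`. In particular
`θ_a ^ 2 = 0` whenever `p(deg a · deg a) = 1`, and a basis of the symmetric algebra is given by
the ordered monomials `θ_0^{β_0} θ_1^{β_1} ⋯` with `β_a ≤ 1` for these `a`. -/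

section Series

variable {I : Type*} [NonUnitalCommSemiring I]

/-- The exponents `β` of the non-zero ordered monomials `θ^β`. -/
def Adm (p : I →+ ZMod 2) {N : ℕ} (deg : Fin N → I) (β : Fin N →₀ ℕ) : Prop :=
  ∀ a, p (deg a * deg a) = 1 → β a ≤ 1

/-- The number of sign changes needed to reorder `θ^α θ^β` to `± θ^{α+β}`. -/
def swaps (p : I →+ ZMod 2) {N : ℕ} (deg : Fin N → I) (α β : Fin N →₀ ℕ) : ℕ :=
  ∑ a, ∑ b, if b < a ∧ p (deg a * deg b) = 1 then α a * β b else 0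

/-- Formal power series `∑ f_β θ^β` with coefficients in `R`; this is
`∏_n S^n(V)` for the free graded `R`-module `V` on the `θ_a`. -/
def GSeries (p : I →+ ZMod 2) {N : ℕ} (deg : Fin N → I) (R : Type*) : Type _ :=
  {β : Fin N →₀ ℕ // Adm p deg β} → R

variable {p : I →+ ZMod 2} {N : ℕ} {deg : Fin N → I}

theorem adm_zero : Adm p deg 0 := fun _ _ => by simp

theorem Adm.of_le {α β : Fin N →₀ ℕ} (h : Adm p deg β) (hle : α ≤ β) : Adm p deg α :=
  fun a ha => (hle a).trans (h a ha)

theorem swaps_add_left (α α' β : Fin N →₀ ℕ) :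
    swaps p deg (α + α') β = swaps p deg α β + swaps p deg α' β := by
  simp only [swaps, ← Finset.sum_add_distrib]
  refine Finset.sum_congr rfl fun a _ => Finset.sum_congr rfl fun b _ => ?_
  split_ifs <;> simp [add_mul]

theorem swaps_add_right (α β β' : Fin N →₀ ℕ) :
    swaps p deg α (β + β') = swaps p deg α β + swaps p deg α β' := by
  simp only [swaps, ← Finset.sum_add_distrib]
  refine Finset.sum_congr rfl fun a _ => Finset.sum_congr rfl fun b _ => ?_
  split_ifs <;> simp [mul_add]

theorem swaps_zero_left (β : Fin N →₀ ℕ) : swaps p deg 0 β = 0 := by simp [swaps]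

theorem swaps_zero_right (α : Fin N →₀ ℕ) : swaps p deg α 0 = 0 := by simp [swaps]

namespace GSeries

section Ring

set_option linter.unusedSectionVars false

variable {R : Type*} [CommRing R] [Algebra ℝ R]

instance : AddCommGroup (GSeries p deg R) :=
  inferInstanceAs (AddCommGroup ({β : Fin N →₀ ℕ // Adm p deg β} → R))

instance : Module ℝ (GSeries p deg R) :=
  inferInstanceAs (Module ℝ ({β : Fin N →₀ ℕ // Adm p deg β} → R))

open Classical in
/-- The coefficient of `θ^β` (zero if `θ^β = 0`). -/
def coeff (β : Fin N →₀ ℕ) (f : GSeries p deg R) : R :=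
  if h : Adm p deg β then f ⟨β, h⟩ else 0

theorem coeff_of_adm {β : Fin N →₀ ℕ} (h : Adm p deg β) (f : GSeries p deg R) :
    coeff β f = f ⟨β, h⟩ := dif_pos h

theorem coeff_of_not_adm {β : Fin N →₀ ℕ} (h : ¬ Adm p deg β) (f : GSeries p deg R) :
    coeff β f = 0 := dif_neg h

theorem ext_coeff {f g : GSeries p deg R} (h : ∀ β, Adm p deg β → coeff β f = coeff β g) :
    f = g := by
  funext β
  have := h β.1 β.2
  rwa [coeff_of_adm β.2, coeff_of_adm β.2] at this

theorem coeff_add (β : Fin N →₀ ℕ) (f g : GSeries p deg R) :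
    coeff β (f + g) = coeff β f + coeff β g := by
  by_cases h : Adm p deg β
  · simp only [coeff_of_adm h]; rfl
  · simp [coeff_of_not_adm h]

theorem coeff_smul (β : Fin N →₀ ℕ) (r : ℝ) (f : GSeries p deg R) :
    coeff β (r • f) = r • coeff β f := by
  by_cases h : Adm p deg β
  · simp only [coeff_of_adm h]; rfl
  · simp [coeff_of_not_adm h]

theorem coeff_zero (β : Fin N →₀ ℕ) : coeff β (0 : GSeries p deg R) = 0 := by
  by_cases h : Adm p deg β
  · simp only [coeff_of_adm h]; rfl
  · simp [coeff_of_not_adm h]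

open Classical in
/-- The constant series `r`: this is the canonical embedding of the coefficients. -/
def const (r : R) : GSeries p deg R := fun β => if β.1 = 0 then r else 0

/-- The canonical body map `ε`. -/
def body (f : GSeries p deg R) : R := coeff 0 f

open Classical in
theorem coeff_const (β : Fin N →₀ ℕ) (r : R) :
    coeff β (const r : GSeries p deg R) = if β = 0 then r else 0 := by
  by_cases h : Adm p deg β
  · rw [coeff_of_adm h]; rfl
  · rw [coeff_of_not_adm h, if_neg]
    rintro rfl
    exact h adm_zero

instance : One (GSeries p deg R) := ⟨const 1⟩

/-- `(f g)_γ = ∑_{α + β = γ} ± f_α g_β`, the sign being that of `θ^α θ^β = ± θ^γ`. -/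
instance : Mul (GSeries p deg R) :=
  ⟨fun f g γ => ∑ q ∈ Finset.HasAntidiagonal.antidiagonal γ.1,
    (-1 : R) ^ swaps p deg q.1 q.2 * (coeff q.1 f * coeff q.2 g)⟩

theorem coeff_mul {γ : Fin N →₀ ℕ} (h : Adm p deg γ) (f g : GSeries p deg R) :
    coeff γ (f * g) = ∑ q ∈ Finset.HasAntidiagonal.antidiagonal γ,
      (-1 : R) ^ swaps p deg q.1 q.2 * (coeff q.1 f * coeff q.2 g) := by
  rw [coeff_of_adm h]; rfl

theorem coeff_const_mul (γ : Fin N →₀ ℕ) (r : R) (f : GSeries p deg R) :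
    coeff γ (const r * f) = r * coeff γ f := by
  classical
  by_cases h : Adm p deg γ
  · rw [coeff_mul h, Finset.sum_eq_single (0, γ)]
    · simp [coeff_const, swaps_zero_left]
    · rintro ⟨a, b⟩ hq hne
      have : a ≠ 0 := by
        rintro rfl
        apply hne
        simpa using hq
      simp [coeff_const, this]
    · intro hn
      exact absurd (by simp) hn
  · simp [coeff_of_not_adm h]

theorem coeff_mul_const (γ : Fin N →₀ ℕ) (r : R) (f : GSeries p deg R) :
    coeff γ (f * const r) = coeff γ f * r := by
  classical
  by_cases h : Adm p deg γ
  · rw [coeff_mul h, Finset.sum_eq_single (γ, 0)]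
    · simp [coeff_const, swaps_zero_right]
    · rintro ⟨a, b⟩ hq hne
      have : b ≠ 0 := by
        rintro rfl
        apply hne
        simpa using hq
      simp [coeff_const, this]
    · intro hn
      exact absurd (by simp) hn
  · simp [coeff_of_not_adm h]

theorem mul_assoc_aux (f g h : GSeries p deg R) : f * g * h = f * (g * h) := by
  classical
  refine ext_coeff fun γ hγ => ?_
  rw [coeff_mul hγ, coeff_mul hγ]
  have hL : ∀ q ∈ Finset.HasAntidiagonal.antidiagonal γ,
      (-1 : R) ^ swaps p deg q.1 q.2 * (coeff q.1 (f * g) * coeff q.2 h) =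
      ∑ r ∈ Finset.HasAntidiagonal.antidiagonal q.1, (-1 : R) ^ swaps p deg q.1 q.2 *
        (((-1 : R) ^ swaps p deg r.1 r.2 * (coeff r.1 f * coeff r.2 g)) * coeff q.2 h) := by
    intro q hq
    have hle : q.1 ≤ γ := by
      rw [← Finset.HasAntidiagonal.mem_antidiagonal.1 hq]; exact le_self_add
    rw [coeff_mul (hγ.of_le hle), Finset.sum_mul, Finset.mul_sum]
  have hR : ∀ q ∈ Finset.HasAntidiagonal.antidiagonal γ,
      (-1 : R) ^ swaps p deg q.1 q.2 * (coeff q.1 f * coeff q.2 (g * h)) =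
      ∑ r ∈ Finset.HasAntidiagonal.antidiagonal q.2, (-1 : R) ^ swaps p deg q.1 q.2 *
        (coeff q.1 f * ((-1 : R) ^ swaps p deg r.1 r.2 * (coeff r.1 g * coeff r.2 h))) := by
    intro q hq
    have hle : q.2 ≤ γ := by
      rw [← Finset.HasAntidiagonal.mem_antidiagonal.1 hq]; exact le_add_self
    rw [coeff_mul (hγ.of_le hle), Finset.mul_sum, Finset.mul_sum]
  rw [Finset.sum_congr rfl hL, Finset.sum_congr rfl hR, Finset.sum_sigma', Finset.sum_sigma']
  refine Finset.sum_nbij'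
    (fun ⟨⟨_, k⟩, ⟨i, j⟩⟩ => ⟨(i, j + k), (j, k)⟩)
    (fun ⟨⟨i, _⟩, ⟨j, k⟩⟩ => ⟨(i + j, k), (i, j)⟩) ?_ ?_ ?_ ?_ ?_
  · rintro ⟨⟨a, k⟩, ⟨i, j⟩⟩ hm
    simp only [Finset.mem_sigma, Finset.HasAntidiagonal.mem_antidiagonal] at hm ⊢
    obtain ⟨h1, h2⟩ := hm
    subst h2
    exact ⟨by rw [← h1, add_assoc], trivial⟩
  · rintro ⟨⟨i, a⟩, ⟨j, k⟩⟩ hm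
    simp only [Finset.mem_sigma, Finset.HasAntidiagonal.mem_antidiagonal] at hm ⊢
    obtain ⟨h1, h2⟩ := hm
    subst h2
    exact ⟨by rw [← h1, add_assoc], trivial⟩
  · rintro ⟨⟨a, k⟩, ⟨i, j⟩⟩ hm
    simp only [Finset.mem_sigma, Finset.HasAntidiagonal.mem_antidiagonal] at hm
    obtain ⟨h1, h2⟩ := hm
    subst h2
    rfl
  · rintro ⟨⟨i, a⟩, ⟨j, k⟩⟩ hm
    simp only [Finset.mem_sigma, Finset.HasAntidiagonal.mem_antidiagonal] at hm
    obtain ⟨h1, h2⟩ := hm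
    subst h2
    rfl
  · rintro ⟨⟨a, k⟩, ⟨i, j⟩⟩ hm
    simp only [Finset.mem_sigma, Finset.HasAntidiagonal.mem_antidiagonal] at hm
    obtain ⟨h1, h2⟩ := hm
    subst h2
    simp only [swaps_add_left, swaps_add_right, pow_add]
    ring

instance : Ring (GSeries p deg R) where
  __ := (inferInstance : AddCommGroup (GSeries p deg R))
  mul_assoc := mul_assoc_aux
  one_mul f := ext_coeff fun γ _ => by
    change coeff γ (const 1 * f) = _
    rw [coeff_const_mul, one_mul]
  mul_one f := ext_coeff fun γ _ => by
    change coeff γ (f * const 1) = _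
    rw [coeff_mul_const, mul_one]
  left_distrib f g h := ext_coeff fun γ hγ => by
    simp only [coeff_add, coeff_mul hγ, mul_add, Finset.sum_add_distrib]
  right_distrib f g h := ext_coeff fun γ hγ => by
    simp only [coeff_add, coeff_mul hγ, add_mul, mul_add, Finset.sum_add_distrib]
  zero_mul f := ext_coeff fun γ hγ => by
    simp only [coeff_zero, coeff_mul hγ, zero_mul, mul_zero, Finset.sum_const_zero]
  mul_zero f := ext_coeff fun γ hγ => by
    simp only [coeff_zero, coeff_mul hγ, mul_zero, Finset.sum_const_zero]

instance : Algebra ℝ (GSeries p deg R) :=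
  Algebra.ofModule
    (fun r f g => ext_coeff fun γ hγ => by
      simp only [coeff_smul, coeff_mul hγ, Finset.smul_sum, smul_mul_assoc, mul_smul_comm])
    (fun r f g => ext_coeff fun γ hγ => by
      simp only [coeff_smul, coeff_mul hγ, Finset.smul_sum, mul_smul_comm])

variable (p deg R) in
/-- The component of degree `i`: all monomials `θ^β` that occur have degree `∑ β_a deg a = i`. -/
def homog (i : I) : Submodule ℝ (GSeries p deg R) where
  carrier := {f | ∀ β, coeff β f ≠ 0 → ∑ a, β a • deg a = i}
  add_mem' := by
    intro f g hf hg β hβ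
    by_cases h : coeff β f = 0
    · refine hg β fun h' => hβ ?_
      rw [coeff_add, h, h', add_zero]
    · exact hf β h
  zero_mem' := fun β hβ => absurd (coeff_zero β) hβ
  smul_mem' := by
    intro r f hf β hβ
    refine hf β fun h => hβ ?_
    rw [coeff_smul, h, smul_zero]

/-- `f` is the sum of the (possibly infinite) family `s`, coefficient by coefficient: for each
`β` only finitely many members of the family contain `θ^β`. -/
def IsFormalSum {κ : Type*} (s : κ → GSeries p deg R) (f : GSeries p deg R) : Prop :=
  ∀ β, (Function.support fun k => coeff β (s k)).Finite ∧ coeff β f = ∑ᶠ k, coeff β (s k)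

/-- The ordered monomial `t_0^{β_0} t_1^{β_1} ⋯`. -/
def monomial {M : ℕ} (t : Fin M → GSeries p deg R) (β : Fin M → ℕ) : GSeries p deg R :=
  (List.ofFn fun a => t a ^ β a).prod

end Ring

/-- Applying an algebra homomorphism to all coefficients. -/
def map {R S : Type*} [CommRing R] [Algebra ℝ R] [CommRing S] [Algebra ℝ S] (u : R →ₐ[ℝ] S) :
    GSeries p deg R →ₐ[ℝ] GSeries p deg S :=
  have hc : ∀ (β : Fin N →₀ ℕ) (f : GSeries p deg R),
      coeff β (show GSeries p deg S from fun β => u (f β)) = u (coeff β f) := fun β f => by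
    by_cases h : Adm p deg β
    · rw [coeff_of_adm h, coeff_of_adm h]
    · rw [coeff_of_not_adm h, coeff_of_not_adm h, map_zero]
  AlgHom.ofLinearMap
    { toFun := fun f β => u (f β)
      map_add' := fun f g => funext fun β => map_add u (f β) (g β)
      map_smul' := fun r f => funext fun β => map_smul u r (f β) }
    (ext_coeff fun β _ => by
      classical
      refine (hc β 1).trans ?_
      change u (coeff β (const 1)) = coeff β (const 1)
      rw [coeff_const, coeff_const]
      split_ifs <;> simp)
    (fun f g => ext_coeff fun β hβ => by
      refine (hc β (f * g)).trans ?_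
      rw [coeff_mul hβ, coeff_mul hβ, map_sum]
      refine Finset.sum_congr rfl fun q _ => ?_
      simp only [map_mul, map_pow, map_neg, map_one]
      exact congrArg₂ _ rfl (congrArg₂ _ (hc q.1 f).symm (hc q.2 g).symm))

end GSeries

end Series

/-! ### Graded domains and their morphisms -/

/-- An `I`-graded domain: an open set `U` of `ℝⁿ` and a finite dimensional graded vector space
`V` with `V_0 = 0`, given by the degrees `deg a` of a homogeneous basis `(θ_a)`; so
`dim V_i` is the number of `a` with `deg a = i`. -/
structure GDomain (I : Type*) [Zero I] where
  n : ℕ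
  U : Opens (Fin n → ℝ)
  N : ℕ
  deg : Fin N → I
  deg_ne_zero : ∀ a, deg a ≠ 0

variable {I : Type*} [NonUnitalCommSemiring I]

namespace GDomain

/-- The sections `𝒪(W)` over an open set `W ⊆ U` of the structure sheaf: smooth functions on `W`
with values in the algebra of formal power series on `V`. -/
abbrev Sec (p : I →+ ZMod 2) (D : GDomain I) (W : Opens (Fin D.n → ℝ)) : Type _ :=
  GSeries p D.deg (Cinf W)

/-- Restriction of sections. -/
def res (p : I →+ ZMod 2) (D : GDomain I) {W' W : Opens (Fin D.n → ℝ)} (h : W' ≤ W) :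
    D.Sec p W →ₐ[ℝ] D.Sec p W' :=
  GSeries.map (Cinf.res h)

/-- The preimage of an open subset of `U₂` under a continuous map `U₁ → U₂`. -/
def preim {D₁ D₂ : GDomain I} (b : C(D₁.U, D₂.U)) (W : Opens (Fin D₂.n → ℝ)) :
    Opens (Fin D₁.n → ℝ) where
  carrier := {x | ∃ h : x ∈ D₁.U, (b ⟨x, h⟩ : Fin D₂.n → ℝ) ∈ W}
  is_open' := by
    have h1 : IsOpen ((fun x : D₁.U => (b x : Fin D₂.n → ℝ)) ⁻¹' (W : Set (Fin D₂.n → ℝ))) :=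
      W.isOpen.preimage (continuous_subtype_val.comp b.continuous)
    have h2 := D₁.U.isOpen.isOpenMap_subtype_val _ h1
    convert h2 using 1
    ext x
    simp

theorem preim_mono {D₁ D₂ : GDomain I} (b : C(D₁.U, D₂.U)) {W' W : Opens (Fin D₂.n → ℝ)}
    (h : W' ≤ W) : preim b W' ≤ preim b W :=
  fun _ ⟨hx, hb⟩ => ⟨hx, h hb⟩

theorem le_preim {D₁ D₂ : GDomain I} (b : C(D₁.U, D₂.U)) : D₁.U ≤ preim b D₂.U :=
  fun x hx => ⟨hx, (b ⟨x, hx⟩).2⟩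

/-- The germ at `x` of the section `f` is a unit of the stalk. -/
def IsUnitAt (p : I →+ ZMod 2) (D : GDomain I) {W : Opens (Fin D.n → ℝ)} (f : D.Sec p W)
    (x : Fin D.n → ℝ) : Prop :=
  ∃ (W' : Opens (Fin D.n → ℝ)) (h : W' ≤ W), x ∈ W' ∧ IsUnit (D.res p h f)

/-- Morphisms of `I`-graded domains, i.e. of `I`-graded locally ringed spaces over `ℝ`. -/
structure Hom (p : I →+ ZMod 2) (D₁ D₂ : GDomain I) where
  /-- the continuous map of the underlying spaces -/
  base : C(D₁.U, D₂.U)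
  /-- the homomorphism of sheaves of algebras -/
  pull : ∀ W : Opens (Fin D₂.n → ℝ), W ≤ D₂.U → D₂.Sec p W →ₐ[ℝ] D₁.Sec p (preim base W)
  pull_res : ∀ (W' W : Opens (Fin D₂.n → ℝ)) (h : W' ≤ W) (hW : W ≤ D₂.U) (f : D₂.Sec p W),
    pull W' (h.trans hW) (D₂.res p h f) = D₁.res p (preim_mono base h) (pull W hW f)
  /-- the grading is preserved -/
  pull_homog : ∀ (W : Opens (Fin D₂.n → ℝ)) (hW : W ≤ D₂.U) (i : I) (f : D₂.Sec p W),
    f ∈ GSeries.homog p D₂.deg (Cinf W) i →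
      pull W hW f ∈ GSeries.homog p D₁.deg (Cinf (preim base W)) i
  /-- the maps induced on the stalks are local -/
  pull_local : ∀ (W : Opens (Fin D₂.n → ℝ)) (hW : W ≤ D₂.U) (f : D₂.Sec p W) (x : D₁.U),
    (base x : Fin D₂.n → ℝ) ∈ W → D₁.IsUnitAt p (pull W hW f) x → D₂.IsUnitAt p f (base x)

/-- The pullback `φ^* : 𝒪₂(U₂) → 𝒪₁(U₁)` of global sections. -/
def Hom.pullGlobal {p : I →+ ZMod 2} {D₁ D₂ : GDomain I} (φ : Hom p D₁ D₂) :
    D₂.Sec p D₂.U →ₐ[ℝ] D₁.Sec p D₁.U :=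
  (D₁.res p (le_preim φ.base)).comp (φ.pull D₂.U le_rfl)

/-- The map `(ε(y^1), …, ε(y^m)) : W → ℝᵐ`. -/
def bodyMap {p : I →+ ZMod 2} {D : GDomain I} {W : Opens (Fin D.n → ℝ)} {m : ℕ}
    (y : Fin m → D.Sec p W) (w : W) : Fin m → ℝ :=
  fun μ => (GSeries.body (y μ)).1 w

/-- Global coordinate systems `(x^μ, θ_a)` of a graded domain. -/
structure IsCoordinateSystem (p : I →+ ZMod 2) (D : GDomain I) (x : Fin D.n → D.Sec p D.U)
    (θ : Fin D.N → D.Sec p D.U) : Prop where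
  x_mem : ∀ μ, x μ ∈ GSeries.homog p D.deg (Cinf D.U) 0
  θ_mem : ∀ a, θ a ∈ GSeries.homog p D.deg (Cinf D.U) (D.deg a)
  /-- `ε(x)` is a diffeomorphism from `U` onto an open subset of `ℝⁿ` -/
  isOpen_range : IsOpen (Set.range (bodyMap x))
  smooth_inverse : ∃ g : (Fin D.n → ℝ) → (Fin D.n → ℝ),
    ContDiffOn ℝ ∞ g (Set.range (bodyMap x)) ∧ ∀ u : D.U, g (bodyMap x u) = u
  /-- the `θ_a` generate `𝒪(U)` over `C^∞(U)` as an algebra of formal power series: the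
  subalgebra that they generate over `C^∞(U)` is dense in the adic topology -/
  generate : ∀ (f : D.Sec p D.U) (k : ℕ),
    ∃ P ∈ Algebra.adjoin ℝ (Set.range (GSeries.const : Cinf D.U → D.Sec p D.U) ∪ Set.range θ),
      ∀ β : Fin D.N →₀ ℕ, ∑ a, β a < k → GSeries.coeff β (f - P) = 0

/-- The range of the coordinates `ε(x^μ)`, i.e. `U` seen in the coordinate system. -/
def IsCoordinateSystem.image {p : I →+ ZMod 2} {D : GDomain I} {x : Fin D.n → D.Sec p D.U}
    {θ : Fin D.N → D.Sec p D.U} (h : D.IsCoordinateSystem p x θ) : Opens (Fin D.n → ℝ) :=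
  ⟨Set.range (bodyMap x), h.isOpen_range⟩

/-- Grassmann analytic continuation
`g(y) = ∑_α (1/α!) (∂^α g)(ε(y)) (y^1 - ε(y^1))^{α_1} ⋯ (y^m - ε(y^m))^{α_m}` of `g ∈ C^∞(V)`.
The sum is finite in every coefficient, as `y^μ - ε(y^μ)` has no constant term. -/
def continuation {p : I →+ ZMod 2} {D : GDomain I} {W : Opens (Fin D.n → ℝ)} {m : ℕ}
    {V : Opens (Fin m → ℝ)} (g : Cinf V) (y : Fin m → D.Sec p W)
    (hy : ∀ w : W, bodyMap y w ∈ V) : D.Sec p W :=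
  fun β => ∑ᶠ α : Fin m → ℕ, GSeries.coeff β.1
    (GSeries.const ((∏ μ, ((α μ).factorial : ℝ))⁻¹ •
        Cinf.comp (Cinf.pdMulti α g) (fun μ => GSeries.body (y μ)) hy) *
      GSeries.monomial (fun μ => y μ - GSeries.const (GSeries.body (y μ))) α)

/-- `f = ∑_β c_β(y) η^β`, the sum over all ordered monomials in `η` that do not vanish
for reasons of parity; here the `c_β` are smooth functions on `V ⊆ ℝᵐ`. -/
def IsExpansion {p : I →+ ZMod 2} {D : GDomain I} {W : Opens (Fin D.n → ℝ)} {m M : ℕ}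
    {deg : Fin M → I} {V : Opens (Fin m → ℝ)} (c : {β : Fin M →₀ ℕ // Adm p deg β} → Cinf V)
    (y : Fin m → D.Sec p W) (hy : ∀ w : W, bodyMap y w ∈ V) (η : Fin M → D.Sec p W)
    (f : D.Sec p W) : Prop :=
  GSeries.IsFormalSum (fun β => continuation (c β) y hy * GSeries.monomial η β.1) f

end GDomain

end IGraded

end

noncomputable section

namespace IGraded

/-! ### Hadamard's lemma -/

section Hadamard

open MeasureTheory intervalIntegral

/-! The algebra of sections is complete and separated for the filtration by order in the θ's
(`GSeries.filt`). Every formal argument below is therefore made order by order: an error of order k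
is replaced by one of order k + 1.

Substitution. The Taylor series g ↦ ∑ (1/α!) ∂^α g X^α is multiplicative by the Leibniz rule.
Grassmann continuation is this series with its coefficients pulled back along ε(y) and with X^μ
replaced by y^μ - ε(y^μ), which has order at least 1. It is thus an algebra homomorphism with
central values. The map ∑ c_β θ^β ↦ ∑ c_β(y) η^β is one as well, because homogeneous η_a obey the
sign rules of the θ_a, including η_a² = 0 in odd parity. Both are instances of `IsEvalData.evalHom`,
the first with variables of degree 0.

Expansion. Substituting a coordinate system x, θ is bijective. It is onto in order 0 because ε(x) is
a diffeomorphism onto Ω. Density modulo order 2 writes the standard variables as combinations of the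
θ_a, which gives all higher orders by induction, and completeness sums the corrections. It is
injective because on leading coefficients of order k it acts by a square matrix over C^∞(U). That
matrix is surjective by the previous step, hence injective by the Orzech property.

Uniqueness of the morphism. Locality on stalks forces ε(φ^* f) = ε(f) ∘ φ̃. By Hadamard's lemma a
section is, near a prescribed point b, a constant plus multiples of t^μ - b^μ and of the θ_a. So two
homomorphisms that agree on the coordinates differ, at each point, by terms of arbitrarily high
order (`algHom_ext_of_coord`).

Existence. Expanding in x, θ and substituting y, η gives a homomorphism of global sections. Its
values on the standard coordinates can be restricted to, and substituted over, every open W, and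
this yields the morphism of sheaves. -/

theorem hasFDerivAt_intervalIntegral_of_contDiff {E G : Type} [NormedAddCommGroup E]
    [NormedSpace ℝ E] [FiniteDimensional ℝ E] [NormedAddCommGroup G] [NormedSpace ℝ G]
    {f : E × ℝ → G} (hf : ContDiff ℝ 1 f) (x₀ : E) :
    HasFDerivAt (fun x => ∫ t in (0 : ℝ)..1, f (x, t))
      (∫ t in (0 : ℝ)..1, (fderiv ℝ f (x₀, t)).comp (ContinuousLinearMap.inl ℝ E ℝ)) x₀ := by
  have hF' : Continuous fun q : E × ℝ => (fderiv ℝ f q).comp (ContinuousLinearMap.inl ℝ E ℝ) :=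
    (hf.continuous_fderiv one_ne_zero).clm_comp continuous_const
  -- Compactness of ball × [0, 1] supplies the uniform bound required for differentiation under the
  -- integral sign.
  obtain ⟨C, hC⟩ := ((isCompact_closedBall x₀ 1).prod (isCompact_Icc (a := (0 : ℝ)) (b := 1)))
    |>.exists_bound_of_continuousOn hF'.continuousOn
  refine hasFDerivAt_integral_of_dominated_of_fderiv_le
    (F' := fun x t => (fderiv ℝ f (x, t)).comp (ContinuousLinearMap.inl ℝ E ℝ))
    (bound := fun _ => C) (Metric.closedBall_mem_nhds x₀ one_pos) ?_ ?_ ?_ ?_ ?_ ?_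
  · refine Filter.Eventually.of_forall fun x => Continuous.aestronglyMeasurable ?_
    exact hf.continuous.comp (by fun_prop)
  · exact (hf.continuous.comp (by fun_prop)).intervalIntegrable _ _
  · exact Continuous.aestronglyMeasurable (hF'.comp (by fun_prop))
  · refine Filter.Eventually.of_forall fun t ht x hx => hC (x, t) ⟨hx, ?_⟩
    rw [Set.uIoc_of_le zero_le_one] at ht
    exact ⟨ht.1.le, ht.2⟩
  · exact intervalIntegrable_const
  · refine Filter.Eventually.of_forall fun t _ x _ => ?_
    have h1 := (hf.differentiable one_ne_zero (x, t)).hasFDerivAt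
    exact h1.comp x (hasFDerivAt_prodMk_left x t)

/-- The derivative of a parameter integral is again a parameter integral, now with values in `E
→L[ℝ] G`. The induction on the order therefore quantifies over the target. -/
theorem contDiff_intervalIntegral {E : Type} [NormedAddCommGroup E]
    [NormedSpace ℝ E] [FiniteDimensional ℝ E] (n : ℕ) : ∀ {G : Type} [NormedAddCommGroup G]
    [NormedSpace ℝ G] {f : E × ℝ → G}, ContDiff ℝ ∞ f →
    ContDiff ℝ n fun x => ∫ t in (0 : ℝ)..1, f (x, t) := by
  induction n with
  | zero =>
    intro G _ _ f hf
    rw [Nat.cast_zero, contDiff_zero]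
    refine continuous_iff_continuousAt.2 fun x => ?_
    exact (hasFDerivAt_intervalIntegral_of_contDiff (hf.of_le (by simp)) x).continuousAt
  | succ n ih =>
    intro G _ _ f hf
    have hd := hasFDerivAt_intervalIntegral_of_contDiff (hf.of_le (m := 1) (by simp))
    push_cast
    rw [contDiff_succ_iff_fderiv]
    refine ⟨fun x => (hd x).differentiableAt, by simp, ?_⟩
    rw [show fderiv ℝ (fun x => ∫ t in (0 : ℝ)..1, f (x, t)) = _ from
      funext fun x => (hd x).fderiv]
    exact ih (f := fun q => (fderiv ℝ f q).comp (ContinuousLinearMap.inl ℝ E ℝ))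
      ((hf.fderiv_right (m := ∞) (by simp)).clm_comp contDiff_const)

/-- Integrate the derivative of `F` along the segment from `b` to `x` and expand `x - b` in the
standard basis. -/
theorem hadamard_global {n : ℕ} {F : (Fin n → ℝ) → ℝ} (hF : ContDiff ℝ ∞ F) (b : Fin n → ℝ) :
    ∃ g : Fin n → (Fin n → ℝ) → ℝ, (∀ μ, ContDiff ℝ ∞ (g μ)) ∧
      ∀ x, F x = F b + ∑ μ, (x μ - b μ) * g μ x := by
  have hline : ContDiff ℝ ∞ fun q : (Fin n → ℝ) × ℝ => b + q.2 • (q.1 - b) := by fun_prop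
  have hdF : ContDiff ℝ ∞ (fderiv ℝ F) := hF.fderiv_right (by simp)
  refine ⟨fun μ x => ∫ t in (0 : ℝ)..1, fderiv ℝ F (b + t • (x - b)) (Pi.single μ 1),
    fun μ => contDiff_infty.2 fun k => ?_, fun x => ?_⟩
  · exact contDiff_intervalIntegral k
      (f := fun q : (Fin n → ℝ) × ℝ => fderiv ℝ F (b + q.2 • (q.1 - b)) (Pi.single μ 1))
      ((hdF.comp hline).clm_apply contDiff_const)
  · have hcont : ∀ v : Fin n → ℝ, Continuous fun t : ℝ => fderiv ℝ F (b + t • (x - b)) v :=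
      fun v => (hdF.continuous.comp (by fun_prop)).clm_apply continuous_const
    have hder : ∀ t : ℝ, HasDerivAt (fun t : ℝ => F (b + t • (x - b)))
        (fderiv ℝ F (b + t • (x - b)) (x - b)) t := by
      intro t
      have h1 := (hF.differentiable (by simp) (b + t • (x - b))).hasFDerivAt
      have h2 : HasDerivAt (fun t : ℝ => b + t • (x - b)) (x - b) t := by
        simpa using ((hasDerivAt_id t).smul_const (x - b)).const_add b
      exact h1.comp_hasDerivAt t h2
    have hFTC := integral_eq_sub_of_hasDerivAt (a := 0) (b := 1) (fun t _ => hder t)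
      ((hcont _).intervalIntegrable _ _)
    have hsum : ∀ t : ℝ, fderiv ℝ F (b + t • (x - b)) (x - b) =
        ∑ μ, (x μ - b μ) * fderiv ℝ F (b + t • (x - b)) (Pi.single μ 1) := by
      intro t
      have hx : x - b = ∑ μ, (x μ - b μ) • (Pi.single μ 1 : Fin n → ℝ) := by
        ext ν
        simp [Finset.sum_apply, Pi.single_apply]
      conv_lhs => rw [show (fderiv ℝ F (b + t • (x - b))) (x - b) =
        (fderiv ℝ F (b + t • (x - b))) (∑ μ, (x μ - b μ) • (Pi.single μ 1 : Fin n → ℝ)) from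
        congrArg _ hx]
      simp only [map_sum, map_smul, smul_eq_mul]
    simp only [hsum] at hFTC
    rw [integral_finsetSum fun μ _ =>
      ((hcont _).const_mul _).intervalIntegrable _ _] at hFTC
    simp only [intervalIntegral.integral_const_mul] at hFTC
    rw [hFTC]
    simp

/-- The set `V` need not be star-shaped about `b`, so `f` is cut off by a bump function ρ at `b`.
The part ρf is smooth on all of ℝⁿ and the global lemma applies. The part (1 - ρ)f vanishes near
`b`, hence may be divided by |x - b|² = ∑ (x_μ - b_μ)². -/
theorem hadamard_open {n : ℕ} {V : Set (Fin n → ℝ)} (hV : IsOpen V) {f : (Fin n → ℝ) → ℝ}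
    (hf : ContDiffOn ℝ ∞ f V) {b : Fin n → ℝ} (hb : b ∈ V) :
    ∃ g : Fin n → (Fin n → ℝ) → ℝ, (∀ μ, ContDiffOn ℝ ∞ (g μ) V) ∧
      ∀ x ∈ V, f x = f b + ∑ μ, (x μ - b μ) * g μ x := by
  obtain ⟨r, hr, hrV⟩ := Metric.nhds_basis_closedBall.mem_iff.1 (hV.mem_nhds hb)
  let ρ : ContDiffBump b := ⟨r / 2, r, by positivity, by linarith⟩
  have hF : ContDiff ℝ ∞ fun x => ρ x * f x := by
    rw [contDiff_iff_contDiffAt]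
    intro x
    by_cases hx : x ∈ V
    · exact ρ.contDiff.contDiffAt.mul (hf.contDiffAt (hV.mem_nhds hx))
    -- The support of ρ lies inside `V`, so ρf vanishes near `x` whatever values `f` takes outside
    -- `V`.
    · have hx' : x ∉ tsupport ρ := fun h => hx (hrV (by rwa [ρ.tsupport_eq] at h))
      refine (contDiffAt_const (c := (0 : ℝ))).congr_of_eventuallyEq ?_
      filter_upwards [(isClosed_tsupport ρ).isOpen_compl.mem_nhds hx'] with y hy
      rw [image_eq_zero_of_notMem_tsupport hy, zero_mul]
  obtain ⟨G, hG, hGe⟩ := hadamard_global hF b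
  have hρb : ρ b = 1 := ρ.one_of_mem_closedBall (Metric.mem_closedBall_self (by positivity))
  have hpos : ∀ x, x ≠ b → ∑ ν, (x ν - b ν) ^ 2 ≠ 0 := by
    intro x hx h
    apply hx
    funext ν
    have := (Finset.sum_eq_zero_iff_of_nonneg fun ν _ => sq_nonneg (x ν - b ν)).1 h ν
      (Finset.mem_univ _)
    exact sub_eq_zero.1 (pow_eq_zero_iff two_ne_zero |>.1 this)
  have hR : ∀ μ, ContDiffOn ℝ ∞
      (fun x => (x μ - b μ) * ((1 - ρ x) * f x) / ∑ ν, (x ν - b ν) ^ 2) V := by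
    intro μ x hx
    refine ContDiffAt.contDiffWithinAt ?_
    by_cases hxb : x = b
    · subst hxb
      -- Near `b` the numerator is zero because ρ = 1; at `b` itself 0 / 0 = 0 gives the right
      -- value.
      refine (contDiffAt_const (c := (0 : ℝ))).congr_of_eventuallyEq ?_
      filter_upwards [ρ.eventuallyEq_one] with y hy
      rw [hy]
      simp
    · have hfx := hf.contDiffAt (hV.mem_nhds hx)
      have hρx : ContDiffAt ℝ ∞ ρ x := ρ.contDiff.contDiffAt
      refine ContDiffAt.div ?_ (by fun_prop) (hpos x hxb)
      exact ContDiffAt.mul (by fun_prop) ((contDiffAt_const.sub hρx).mul hfx)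
  refine ⟨fun μ x => G μ x + (x μ - b μ) * ((1 - ρ x) * f x) / ∑ ν, (x ν - b ν) ^ 2,
    fun μ => (hG μ).contDiffOn.add (hR μ), fun x _ => ?_⟩
  have h1 := hGe x
  simp only [hρb, one_mul] at h1
  by_cases hxb : x = b
  · subst hxb; simp
  have h2 : ∑ μ, (x μ - b μ) * ((x μ - b μ) * ((1 - ρ x) * f x) / ∑ ν, (x ν - b ν) ^ 2) =
      (1 - ρ x) * f x := by
    have : ∀ μ, (x μ - b μ) * ((x μ - b μ) * ((1 - ρ x) * f x) / ∑ ν, (x ν - b ν) ^ 2) =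
        (x μ - b μ) ^ 2 * ((1 - ρ x) * f x / ∑ ν, (x ν - b ν) ^ 2) := fun μ => by ring
    simp only [this]
    rw [← Finset.sum_mul, mul_div_cancel₀ _ (hpos x hxb)]
  simp only [mul_add, Finset.sum_add_distrib]
  rw [h2]
  linarith

end Hadamard

/-! ### Calculus in `C^∞(W)` -/

namespace Cinf

open scoped Topology

variable {n : ℕ} {W : Opens (Fin n → ℝ)}

theorem zeroExt_eventuallyEq {f : W → ℝ} {g : (Fin n → ℝ) → ℝ} {V : Opens (Fin n → ℝ)}
    {x : Fin n → ℝ} (hx : x ∈ V) (hV : V ≤ W) (h : ∀ (y) (hy : y ∈ V), f ⟨y, hV hy⟩ = g y) :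
    zeroExt f =ᶠ[𝓝 x] g := by
  filter_upwards [V.isOpen.mem_nhds hx] with y hy
  exact (zeroExt_apply f ⟨y, hV hy⟩).trans (h y hy)

theorem contDiffAt_zeroExt (f : Cinf W) (x : W) : ContDiffAt ℝ ∞ (zeroExt f.1) x :=
  (contDiffOn_zeroExt f).contDiffAt (W.isOpen.mem_nhds x.2)

theorem differentiableAt_zeroExt (f : Cinf W) (x : W) : DifferentiableAt ℝ (zeroExt f.1) x :=
  (contDiffAt_zeroExt f x).differentiableAt (by simp)

theorem pd_apply_eq {f : Cinf W} {g : (Fin n → ℝ) → ℝ} {x : W}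
    (h : zeroExt f.1 =ᶠ[𝓝 (x : Fin n → ℝ)] g) (μ : Fin n) :
    (pd μ f).1 x = fderiv ℝ g x (Pi.single μ 1) := by
  change fderiv ℝ (zeroExt f.1) x (Pi.single μ 1) = _
  rw [h.fderiv_eq]

variable (W) in
/-- The coordinate function `t^μ` on `W`. -/
def coord (μ : Fin n) : Cinf W :=
  ⟨fun x => x.1 μ, fun x => x μ, by fun_prop, fun _ => rfl⟩

variable (W) in
/-- The partial derivative `∂_μ` as a derivation. -/
def pdDerivation (μ : Fin n) : Derivation ℝ (Cinf W) (Cinf W) :=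
  Derivation.mk'
    { toFun := pd μ
      map_add' := fun f g => by
        refine Subtype.ext (funext fun x => ?_)
        rw [pd_apply_eq (zeroExt_eventuallyEq (g := zeroExt f.1 + zeroExt g.1) x.2 le_rfl
            fun y hy => by
              simp [← zeroExt_apply f.1 ⟨y, hy⟩, ← zeroExt_apply g.1 ⟨y, hy⟩]),
          fderiv_add (differentiableAt_zeroExt f x) (differentiableAt_zeroExt g x)]
        rfl
      map_smul' := fun r f => by
        refine Subtype.ext (funext fun x => ?_)
        rw [pd_apply_eq (zeroExt_eventuallyEq (g := r • zeroExt f.1) x.2 le_rfl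
            fun y hy => by simp [← zeroExt_apply f.1 ⟨y, hy⟩]),
          fderiv_const_smul (differentiableAt_zeroExt f x)]
        rfl }
    fun f g => by
      refine Subtype.ext (funext fun x => ?_)
      change (pd μ (f * g)).1 x = f.1 x * (pd μ g).1 x + g.1 x * (pd μ f).1 x
      rw [pd_apply_eq (zeroExt_eventuallyEq (g := zeroExt f.1 * zeroExt g.1) x.2 le_rfl
          fun y hy => by
            simp [← zeroExt_apply f.1 ⟨y, hy⟩, ← zeroExt_apply g.1 ⟨y, hy⟩]),
        fderiv_mul (differentiableAt_zeroExt f x) (differentiableAt_zeroExt g x)]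
      simp only [zeroExt_apply]
      rfl

theorem pdDerivation_apply (μ : Fin n) (f : Cinf W) : pdDerivation W μ f = pd μ f := rfl

theorem pd_comm (μ ν : Fin n) (f : Cinf W) : pd μ (pd ν f) = pd ν (pd μ f) := by
  have key : ∀ (μ ν : Fin n) (x : W), (pd μ (pd ν f)).1 x =
      fderiv ℝ (fderiv ℝ (zeroExt f.1)) x (Pi.single μ 1) (Pi.single ν 1) := by
    intro μ ν x
    rw [pd_apply_eq (zeroExt_eventuallyEq
      (g := fun y => fderiv ℝ (zeroExt f.1) y (Pi.single ν 1)) x.2 le_rfl fun y hy => rfl)]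
    have hd : DifferentiableAt ℝ (fderiv ℝ (zeroExt f.1)) x :=
      ((contDiffAt_zeroExt f x).fderiv_right (m := ∞) (by simp)).differentiableAt (by simp)
    rw [fderiv_clm_apply hd (differentiableAt_const _)]
    simp
  refine Subtype.ext (funext fun x => ?_)
  rw [key, key]
  exact ((contDiffAt_zeroExt f x).isSymmSndFDerivAt (by
    rw [minSmoothness_of_isRCLikeNormedField]
    exact WithTop.coe_le_coe.2 (le_top : (2 : ℕ∞) ≤ ⊤))) _ _

theorem pd_coord (μ ν : Fin n) : pd μ (coord W ν) = if μ = ν then 1 else 0 := by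
  refine Subtype.ext (funext fun x => ?_)
  rw [pd_apply_eq (zeroExt_eventuallyEq (g := ContinuousLinearMap.proj (R := ℝ)
    (φ := fun _ : Fin n => ℝ) ν) x.2 le_rfl fun y hy => rfl), ContinuousLinearMap.fderiv]
  split_ifs with h
  · subst h; simp
  · simp [Ne.symm h]

theorem pd_res {W' : Opens (Fin n → ℝ)} (h : W' ≤ W) (μ : Fin n) (f : Cinf W) :
    pd μ (res h f) = res h (pd μ f) := by
  refine Subtype.ext (funext fun x => ?_)
  refine (pd_apply_eq (zeroExt_eventuallyEq (g := zeroExt f.1) x.2 le_rfl fun y hy => ?_) μ)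
  exact (zeroExt_apply f.1 ⟨y, h hy⟩).symm

/-- The iterated partial derivatives `∂_{l_1}^{α_1} ∂_{l_2}^{α_2} ⋯` along a list of indices. -/
def pdList (l : List (Fin n)) (α : Fin n → ℕ) (f : Cinf W) : Cinf W :=
  l.foldr (fun μ h => (pd μ)^[α μ] h) f

theorem pdMulti_eq_pdList (α : Fin n → ℕ) (f : Cinf W) :
    pdMulti α f = pdList (List.finRange n) α f := rfl

theorem pdList_pd (l : List (Fin n)) (α : Fin n → ℕ) (μ : Fin n) (f : Cinf W) :
    pdList l α (pd μ f) = pd μ (pdList l α f) := by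
  induction l with
  | nil => rfl
  | cons ν l ih =>
    change (pd ν)^[α ν] (pdList l α (pd μ f)) = pd μ ((pd ν)^[α ν] (pdList l α f))
    rw [ih]
    exact ((show Function.Commute (pd (W := W) μ) (pd ν) from
      fun f => pd_comm μ ν f).iterate_right _ _).symm

theorem pdList_congr {l : List (Fin n)} {α β : Fin n → ℕ} (h : ∀ μ ∈ l, α μ = β μ) (f : Cinf W) :
    pdList l α f = pdList l β f := by
  induction l with
  | nil => rfl
  | cons ν l ih =>
    change (pd ν)^[α ν] (pdList l α f) = (pd ν)^[β ν] (pdList l β f)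
    rw [ih fun μ hμ => h μ (List.mem_cons_of_mem _ hμ), h ν List.mem_cons_self]

/-- As `l` has no repetitions, exactly one block of derivatives gets longer; the additional `pd μ`
is moved to the front by commutation. -/
theorem pdList_succ {l : List (Fin n)} (hl : l.Nodup) {μ : Fin n} (hμ : μ ∈ l)
    {α β : Fin n → ℕ} (h : β μ = α μ + 1) (h' : ∀ ν, ν ≠ μ → β ν = α ν) (f : Cinf W) :
    pdList l β f = pd μ (pdList l α f) := by
  induction l with
  | nil => simp at hμ
  | cons ν l ih =>
    change (pd ν)^[β ν] (pdList l β f) = pd μ ((pd ν)^[α ν] (pdList l α f))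
    rw [List.nodup_cons] at hl
    by_cases e : ν = μ
    · subst e
      rw [h, Function.iterate_succ_apply',
        pdList_congr (fun μ hμ => h' μ fun e => hl.1 (e ▸ hμ))]
    · rw [ih hl.2 ((List.mem_cons.1 hμ).resolve_left (Ne.symm e)), h' ν e]
      exact ((show Function.Commute (pd (W := W) μ) (pd ν) from
        fun f => pd_comm μ ν f).iterate_right _ _).symm

theorem pdMulti_succ {μ : Fin n} {α β : Fin n → ℕ} (h : β μ = α μ + 1)
    (h' : ∀ ν, ν ≠ μ → β ν = α ν) (f : Cinf W) : pdMulti β f = pdMulti α (pd μ f) := by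
  rw [pdMulti_eq_pdList, pdMulti_eq_pdList, pdList_pd,
    pdList_succ (List.nodup_finRange n) (List.mem_finRange μ) h h']

theorem pdMulti_zero (f : Cinf W) : pdMulti 0 f = f := by
  rw [pdMulti_eq_pdList]
  induction List.finRange n with
  | nil => rfl
  | cons ν l ih => exact ih

variable (W) in
/-- `∂^α` as a linear map. -/
def pdMultiₗ (α : Fin n → ℕ) : Cinf W →ₗ[ℝ] Cinf W :=
  (List.finRange n).foldr (fun μ L => ((pdDerivation W μ : Cinf W →ₗ[ℝ] Cinf W) ^ α μ) ∘ₗ L)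
    LinearMap.id

theorem pdMultiₗ_apply (α : Fin n → ℕ) (f : Cinf W) : pdMultiₗ W α f = pdMulti α f := by
  rw [pdMulti_eq_pdList, pdMultiₗ]
  induction List.finRange n with
  | nil => rfl
  | cons ν l ih =>
    change ((pdDerivation W ν : Cinf W →ₗ[ℝ] Cinf W) ^ α ν) _ = (pd ν)^[α ν] (pdList l α f)
    rw [ih, Module.End.pow_apply]
    rfl

theorem pdMulti_res {W' : Opens (Fin n → ℝ)} (h : W' ≤ W) (α : Fin n → ℕ) (f : Cinf W) :
    pdMulti α (res h f) = res h (pdMulti α f) := by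
  rw [pdMulti_eq_pdList, pdMulti_eq_pdList]
  induction List.finRange n with
  | nil => rfl
  | cons ν l ih =>
    change (pd ν)^[α ν] (pdList l α (res h f)) = res h ((pd ν)^[α ν] (pdList l α f))
    rw [ih]
    exact (Function.Semiconj.iterate_right (f := res h) (ga := pd ν) (gb := pd ν)
      (fun f => (pd_res h ν f).symm) _ _).symm

theorem hadamard (f : Cinf W) (b : W) : ∃ g : Fin n → Cinf W,
    f = algebraMap ℝ _ (f.1 b) + ∑ μ, (coord W μ - algebraMap ℝ _ (b.1 μ)) * g μ := by
  obtain ⟨g, hg, e⟩ := hadamard_open W.isOpen (contDiffOn_zeroExt f) b.2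
  refine ⟨fun μ => ⟨fun x => g μ x, g μ, hg μ, fun _ => rfl⟩, Subtype.ext (funext fun x => ?_)⟩
  have h := e x x.2
  rw [zeroExt_apply, zeroExt_apply] at h
  rw [h]
  simp [Finset.sum_apply, coord]

theorem isUnit_of_ne_zero (f : Cinf W) (h : ∀ x, f.1 x ≠ 0) : IsUnit f := by
  refine IsUnit.of_mul_eq_one ⟨fun x => (f.1 x)⁻¹, fun x => (zeroExt f.1 x)⁻¹, ?_, fun x => ?_⟩ ?_
  · refine (contDiffOn_zeroExt f).inv fun x hx => ?_
    rw [zeroExt_apply f.1 ⟨x, hx⟩]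
    exact h _
  · simp [zeroExt_apply]
  · exact Subtype.ext (funext fun x => mul_inv_cancel₀ (h x))

theorem continuous_coe (f : Cinf W) : Continuous f.1 := by
  have h := (contDiffOn_zeroExt f).continuousOn.domRestrict
  rwa [show (W : Set (Fin n → ℝ)).domRestrict (zeroExt f.1) = f.1 from
    funext fun x => zeroExt_apply f.1 x] at h

/-- Substitution `g ↦ g(t_1, …, t_m)`, as an algebra homomorphism. -/
def compHom {m : ℕ} {V : Opens (Fin m → ℝ)} (t : Fin m → Cinf W)
    (ht : ∀ w : W, (fun μ => (t μ).1 w) ∈ V) : Cinf V →ₐ[ℝ] Cinf W where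
  toFun g := comp g t ht
  map_one' := rfl
  map_mul' _ _ := rfl
  map_zero' := rfl
  map_add' _ _ := rfl
  commutes' _ := rfl

/-! ### Taylor coefficients -/

/-- The Taylor series `∑_α (1/α!) ∂^α f X^α`. -/
def taylorSeries (f : Cinf W) : MvPowerSeries (Fin n) (Cinf W) :=
  fun α => (∏ μ, ((α μ).factorial : ℝ))⁻¹ • pdMulti α f

theorem coeff_taylorSeries (α : Fin n →₀ ℕ) (f : Cinf W) :
    MvPowerSeries.coeff α (taylorSeries f) = (∏ μ, ((α μ).factorial : ℝ))⁻¹ • pdMulti α f := rfl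

theorem prod_factorial_add_single (α : Fin n →₀ ℕ) (μ : Fin n) :
    (∏ ν, (((α + Finsupp.single μ 1 : Fin n →₀ ℕ) ν).factorial : ℝ)) =
      (α μ + 1) * ∏ ν, ((α ν).factorial : ℝ) := by
  rw [← Finset.mul_prod_erase _ _ (Finset.mem_univ μ), ← Finset.mul_prod_erase Finset.univ
    (fun ν => ((α ν).factorial : ℝ)) (Finset.mem_univ μ), ← mul_assoc]
  congr 1
  · simp [Nat.factorial_succ]
  · refine Finset.prod_congr rfl fun ν hν => ?_
    simp [(Finset.ne_of_mem_erase hν)]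

/-- The factor α_μ + 1 is the quotient (α + e_μ)!/α!. This recursion, in which the coefficient at α
+ e_μ is recovered from ∂_μ f, drives the inductions on the order below. -/
theorem coeff_taylorSeries_add_single (α : Fin n →₀ ℕ) (μ : Fin n) (f : Cinf W) :
    ((α μ : ℝ) + 1) • MvPowerSeries.coeff (α + Finsupp.single μ 1) (taylorSeries f) =
      MvPowerSeries.coeff α (taylorSeries (pd μ f)) := by
  rw [coeff_taylorSeries, coeff_taylorSeries, prod_factorial_add_single,
    pdMulti_succ (μ := μ) (α := α) (by simp) (fun ν hν => by simp [hν]), smul_smul, mul_inv,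
    ← mul_assoc, mul_inv_cancel₀ (by positivity), one_mul]

theorem pderiv_taylorSeries (μ : Fin n) (f : Cinf W) :
    MvPowerSeries.pderiv (Cinf W) μ (taylorSeries f) = taylorSeries (pd μ f) := by
  ext1 α
  rw [MvPowerSeries.coeff_pderiv, ← coeff_taylorSeries_add_single, Algebra.smul_def, mul_comm]
  simp

theorem taylorSeries_add (f g : Cinf W) :
    taylorSeries (f + g) = taylorSeries f + taylorSeries g := by
  ext1 α
  simp only [map_add, coeff_taylorSeries, ← pdMultiₗ_apply, smul_add]

theorem taylorSeries_smul (r : ℝ) (f : Cinf W) :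
    taylorSeries (r • f) = r • taylorSeries f := by
  ext1 α
  change _ = r • MvPowerSeries.coeff α (taylorSeries f)
  simp only [coeff_taylorSeries, ← pdMultiₗ_apply, map_smul]
  rw [smul_comm]

theorem coeff_zero_taylorSeries (f : Cinf W) :
    MvPowerSeries.coeff 0 (taylorSeries f) = f := by
  rw [coeff_taylorSeries]
  simpa using pdMulti_zero f

/-- Formal ∂/∂X_μ corresponds to `pd μ` on functions, and both are derivations. Hence the two sides
have the same formal derivatives up to the induction hypothesis, and the coefficients follow by
induction on the order of α. -/
theorem taylorSeries_mul (f g : Cinf W) :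
    taylorSeries (f * g) = taylorSeries f * taylorSeries g := by
  have key : ∀ (k : ℕ) (α : Fin n →₀ ℕ), ∑ μ, α μ = k → ∀ f g : Cinf W,
      MvPowerSeries.coeff α (taylorSeries (f * g)) =
        MvPowerSeries.coeff α (taylorSeries f * taylorSeries g) := by
    intro k
    induction k with
    | zero =>
      intro α hα f g
      have : α = 0 := by
        ext μ
        exact Finset.sum_eq_zero_iff.1 hα μ (Finset.mem_univ μ)
      subst this
      rw [coeff_zero_taylorSeries]
      have := coeff_zero_taylorSeries f
      have := coeff_zero_taylorSeries g
      simp_all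
    | succ k ih =>
      intro α hα f g
      obtain ⟨μ, hμ⟩ : ∃ μ, α μ ≠ 0 := by
        by_contra! h
        simp [h] at hα
      obtain ⟨β, rfl⟩ : ∃ β, α = β + Finsupp.single μ 1 :=
        ⟨α - Finsupp.single μ 1, (tsub_add_cancel_of_le (by
          simpa [Nat.one_le_iff_ne_zero] using hμ)).symm⟩
      have hβ : ∑ ν, β ν = k := by
        simpa [Finset.sum_add_distrib, Finsupp.single_apply] using hα
      have h1 := MvPowerSeries.coeff_pderiv (taylorSeries (f * g)) β (i := μ)
      have h2 := MvPowerSeries.coeff_pderiv (taylorSeries f * taylorSeries g) β (i := μ)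
      rw [pderiv_taylorSeries, ← pdDerivation_apply, Derivation.leibniz, smul_eq_mul, smul_eq_mul,
        taylorSeries_add, map_add, ih β hβ, ih β hβ] at h1
      rw [Derivation.leibniz, map_add, pderiv_taylorSeries, pderiv_taylorSeries, smul_eq_mul,
        smul_eq_mul] at h2
      have h3 := h1.symm.trans h2
      -- The integer factor produced by the formal derivative is invertible in an ℝ-algebra, so it
      -- can be cancelled.
      have hu : IsUnit ((β μ : Cinf W) + 1) := by
        have := (show ((β μ : ℝ) + 1) ≠ 0 by positivity).isUnit.map (algebraMap ℝ (Cinf W))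
        simpa using this
      exact hu.mul_right_cancel h3
  ext1 α
  exact key _ α rfl f g

theorem exists_eq_add_single {α : Fin n →₀ ℕ} (hα : α ≠ 0) :
    ∃ β μ, α = β + Finsupp.single μ 1 := by
  obtain ⟨μ, hμ⟩ := Finsupp.ne_iff.1 hα
  exact ⟨α - Finsupp.single μ 1, μ, (tsub_add_cancel_of_le (by
    simpa [Nat.one_le_iff_ne_zero] using hμ)).symm⟩

theorem coeff_taylorSeries_one {α : Fin n →₀ ℕ} (hα : α ≠ 0) :
    MvPowerSeries.coeff α (taylorSeries (1 : Cinf W)) = 0 := by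
  obtain ⟨β, μ, rfl⟩ := exists_eq_add_single hα
  have h := coeff_taylorSeries_add_single β μ (1 : Cinf W)
  rw [← pdDerivation_apply, Derivation.map_one_eq_zero] at h
  have h0 : taylorSeries (0 : Cinf W) = 0 := by simpa using taylorSeries_smul (0 : ℝ) (0 : Cinf W)
  rw [h0, map_zero] at h
  exact (smul_eq_zero.1 h).resolve_left (by positivity)

theorem coeff_taylorSeries_coord {α : Fin n →₀ ℕ} (hα : α ≠ 0) (μ : Fin n) :
    MvPowerSeries.coeff α (taylorSeries (coord W μ)) = if α = Finsupp.single μ 1 then 1 else 0 := by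
  obtain ⟨β, ν, rfl⟩ := exists_eq_add_single hα
  have h := coeff_taylorSeries_add_single β ν (coord W μ)
  have hc : ((β ν : ℝ) + 1) ≠ 0 := by positivity
  have h0 : taylorSeries (0 : Cinf W) = 0 := by simpa using taylorSeries_smul (0 : ℝ) (0 : Cinf W)
  rw [pd_coord] at h
  by_cases hν : ν = μ
  · subst hν
    by_cases hβ : β = 0
    · subst hβ
      simpa [coeff_zero_taylorSeries, -MvPowerSeries.coeff_zero_eq_constantCoeff] using h
    · rw [if_pos rfl, coeff_taylorSeries_one hβ] at h
      rw [if_neg (by simpa using hβ)]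
      exact (smul_eq_zero.1 h).resolve_left hc
  · rw [if_neg hν, h0, map_zero] at h
    rw [if_neg]
    · exact (smul_eq_zero.1 h).resolve_left hc
    · intro e
      have := DFunLike.congr_fun e ν
      simp [Ne.symm hν] at this

end Cinf

/-! ### Degrees and signs -/

section Signs

variable {I : Type*} [NonUnitalCommSemiring I]

/-- The order `∑_a β_a` of an exponent. -/
def wt {N : ℕ} (β : Fin N →₀ ℕ) : ℕ := ∑ a, β a

theorem wt_add {N : ℕ} (α β : Fin N →₀ ℕ) : wt (α + β) = wt α + wt β := by
  simp [wt, Finset.sum_add_distrib]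

theorem wt_zero {N : ℕ} : wt (0 : Fin N →₀ ℕ) = 0 := by simp [wt]

theorem wt_single {N : ℕ} (a : Fin N) (k : ℕ) : wt (Finsupp.single a k) = k := by
  simp [wt, Finsupp.single_apply]

theorem wt_eq_zero {N : ℕ} {β : Fin N →₀ ℕ} : wt β = 0 ↔ β = 0 := by
  refine ⟨fun h => Finsupp.ext fun a => ?_, fun h => h ▸ wt_zero⟩
  exact Finset.sum_eq_zero_iff.1 h a (Finset.mem_univ a)

theorem finite_wt_lt (N K : ℕ) : {β : Fin N →₀ ℕ | wt β < K}.Finite := by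
  refine (Set.finite_Iic (Finsupp.equivFunOnFinite.symm fun _ : Fin N => K)).subset fun β hβ a => ?_
  exact (Finset.single_le_sum (f := fun a => β a) (fun _ _ => Nat.zero_le _)
    (Finset.mem_univ a)).trans (le_of_lt hβ)

/-- The degree `∑_a β_a deg a` of the monomial `θ^β`. -/
def degOf {N : ℕ} (deg : Fin N → I) (β : Fin N →₀ ℕ) : I := ∑ a, β a • deg a

variable {N : ℕ} {deg : Fin N → I} {p : I →+ ZMod 2}

theorem degOf_add (α β : Fin N →₀ ℕ) : degOf deg (α + β) = degOf deg α + degOf deg β := by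
  simp [degOf, Finset.sum_add_distrib, add_smul]

theorem degOf_zero : degOf deg 0 = 0 := by simp [degOf]

theorem degOf_single (a : Fin N) : degOf deg (Finsupp.single a 1) = deg a := by
  rw [degOf, Finset.sum_eq_single a]
  · simp
  · intro b _ hb
    simp [hb]
  · simp

theorem neg_one_pow_congr {R : Type*} [Ring R] {m n : ℕ} (h : (m : ZMod 2) = n) :
    (-1 : R) ^ m = (-1) ^ n := by
  rw [ZMod.natCast_eq_natCast_iff'] at h
  rw [neg_one_pow_eq_pow_mod_two, h, ← neg_one_pow_eq_pow_mod_two]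

theorem zmod_two_eq_ite (z : ZMod 2) : z = if z = 1 then 1 else 0 := by
  revert z; decide

/-- Only the parity of `swaps` affects a sign. Modulo 2 the case distinction becomes the factor
p(deg a · deg b), which makes the count comparable with the bilinear expression in
`parity_degOf_mul`. -/
theorem cast_swaps (α β : Fin N →₀ ℕ) : (swaps p deg α β : ZMod 2) =
    ∑ a, ∑ b, if b < a then (α a : ZMod 2) * β b * p (deg a * deg b) else 0 := by
  rw [swaps]
  push_cast
  refine Finset.sum_congr rfl fun a _ => Finset.sum_congr rfl fun b _ => ?_
  conv_rhs => rw [zmod_two_eq_ite (p (deg a * deg b))]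
  by_cases h1 : b < a <;> by_cases h2 : p (deg a * deg b) = 1 <;> simp [h1, h2]

theorem parity_degOf_mul (α β : Fin N →₀ ℕ) : p (degOf deg α * degOf deg β) =
    ∑ a, ∑ b, (α a : ZMod 2) * β b * p (deg a * deg b) := by
  rw [degOf, degOf, Finset.sum_mul_sum, map_sum]
  refine Finset.sum_congr rfl fun a _ => ?_
  rw [map_sum]
  refine Finset.sum_congr rfl fun b _ => ?_
  rw [smul_mul_assoc, mul_smul_comm, map_nsmul, map_nsmul, nsmul_eq_mul, nsmul_eq_mul, mul_assoc]

/-- The parity of the product of the degrees splits into the pairs b < a, the pairs a < b and the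
diagonal. The first two are the two swap counts. A diagonal term vanishes: if p(deg a · deg a) = 1,
admissibility of α + β leaves α_a or β_a equal to 0. -/
theorem cast_swaps_comm {α β : Fin N →₀ ℕ} (h : Adm p deg (α + β)) :
    (swaps p deg α β : ZMod 2) = p (degOf deg α * degOf deg β) + swaps p deg β α := by
  have h2 : ∀ z : ZMod 2, z + z = 0 := by decide
  have hβα : (swaps p deg β α : ZMod 2) =
      ∑ a, ∑ b, if a < b then (α a : ZMod 2) * β b * p (deg a * deg b) else 0 := by
    rw [cast_swaps, Finset.sum_comm]
    refine Finset.sum_congr rfl fun a _ => Finset.sum_congr rfl fun b _ => ?_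
    rw [mul_comm (β b : ZMod 2), mul_comm (deg b)]
  have hp : p (degOf deg α * degOf deg β) = swaps p deg α β + swaps p deg β α := by
    rw [parity_degOf_mul, hβα, cast_swaps, ← Finset.sum_add_distrib]
    refine Finset.sum_congr rfl fun a _ => ?_
    rw [← Finset.sum_add_distrib]
    refine Finset.sum_congr rfl fun b _ => ?_
    rcases lt_trichotomy a b with hab | rfl | hab
    · simp [hab, hab.not_gt]
    · have h3 : ∀ z : ZMod 2, z = 0 ∨ z = 1 := by decide
      rcases h3 (p (deg a * deg a)) with h0 | h1
      · simp [h0]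
      · have h4 := h a h1
        rw [Finsupp.add_apply] at h4
        have h5 : α a = 0 ∨ β a = 0 := by omega
        rcases h5 with h5 | h5 <;> simp [h5]
    · simp [hab, hab.not_gt]
  rw [hp, add_assoc, h2, add_zero]

theorem neg_one_pow_swaps_comm {R : Type*} [Ring R] {α β : Fin N →₀ ℕ}
    (h : Adm p deg (α + β)) : (-1 : R) ^ swaps p deg α β =
      (-1) ^ (p (degOf deg α * degOf deg β)).val * (-1) ^ swaps p deg β α := by
  rw [← pow_add]
  refine neg_one_pow_congr ?_
  rw [cast_swaps_comm h]
  simp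

/-- Variables of degree 0 are ordinary commuting variables without relations, so Taylor series fit
into the same type of graded series. -/
theorem swaps_degree_zero (α β : Fin N →₀ ℕ) : swaps p (0 : Fin N → I) α β = 0 := by
  simp [swaps]

theorem adm_degree_zero (α : Fin N →₀ ℕ) : Adm p (0 : Fin N → I) α := by
  intro a h
  simp at h

end Signs

/-! ### Ordered monomials in skew-commuting elements -/

section Skew

variable {A : Type*} [Ring A]

/-- `x y = (-1)^k y x`. -/
def SkewCommute (k : ℕ) (x y : A) : Prop := x * y = (-1) ^ k * (y * x)

theorem neg_one_pow_commute (k : ℕ) (x : A) : x * (-1) ^ k = (-1) ^ k * x :=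
  ((Commute.neg_one_left x).pow_left k).symm

theorem SkewCommute.mul_left {k l : ℕ} {x x' y : A} (h : SkewCommute k x y)
    (h' : SkewCommute l x' y) : SkewCommute (k + l) (x * x') y := by
  unfold SkewCommute at *
  rw [mul_assoc, h', ← mul_assoc, neg_one_pow_commute, mul_assoc, ← mul_assoc x y, h, pow_add]
  simp only [mul_assoc]
  rw [← mul_assoc ((-1) ^ l) ((-1) ^ k), ← pow_add, add_comm, pow_add, mul_assoc]

theorem SkewCommute.mul_right {k l : ℕ} {x y y' : A} (h : SkewCommute k x y)
    (h' : SkewCommute l x y') : SkewCommute (k + l) x (y * y') := by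
  unfold SkewCommute at *
  rw [← mul_assoc, h, mul_assoc, mul_assoc, h', ← mul_assoc y, neg_one_pow_commute, pow_add]
  simp only [mul_assoc]

theorem SkewCommute.one_left (y : A) : SkewCommute 0 1 y := by simp [SkewCommute]

theorem SkewCommute.one_right (x : A) : SkewCommute 0 x 1 := by simp [SkewCommute]

theorem SkewCommute.pow_left {k : ℕ} {x y : A} (h : SkewCommute k x y) (m : ℕ) :
    SkewCommute (k * m) (x ^ m) y := by
  induction m with
  | zero => simpa using SkewCommute.one_left y
  | succ m ih => rw [pow_succ, mul_add, mul_one]; exact ih.mul_left h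

theorem SkewCommute.pow_right {k : ℕ} {x y : A} (h : SkewCommute k x y) (m : ℕ) :
    SkewCommute (k * m) x (y ^ m) := by
  induction m with
  | zero => simpa using SkewCommute.one_right x
  | succ m ih => rw [pow_succ, mul_add, mul_one]; exact ih.mul_right h

/-- The ordered product `t_0^{α_0} t_1^{α_1} ⋯`. -/
def ordProd {M : ℕ} (t : Fin M → A) (α : Fin M → ℕ) : A := (List.ofFn fun a => t a ^ α a).prod

theorem ordProd_succ {M : ℕ} (t : Fin (M + 1) → A) (α : Fin (M + 1) → ℕ) :
    ordProd t α = t 0 ^ α 0 * ordProd (fun a => t a.succ) fun a => α a.succ := by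
  simp [ordProd, List.ofFn_succ]

theorem ordProd_skewCommute {M : ℕ} {t : Fin M → A} {x : A} {e : Fin M → ℕ}
    (h : ∀ a, SkewCommute (e a) (t a) x) (α : Fin M → ℕ) :
    SkewCommute (∑ a, e a * α a) (ordProd t α) x := by
  induction M with
  | zero => simpa [ordProd] using SkewCommute.one_left x
  | succ M ih =>
    rw [ordProd_succ, Fin.sum_univ_succ]
    exact ((h 0).pow_left _).mul_left (ih (fun a => h a.succ) _)

/-- Induction on the number of factors: the block of the first variable from β is moved left past
the remaining blocks of α, which accounts for the pairs with b = 0. The relation of an element with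
itself plays no role. -/
theorem ordProd_mul {M : ℕ} {t : Fin M → A} {e : Fin M → Fin M → ℕ}
    (h : ∀ a b, b < a → SkewCommute (e a b) (t a) (t b)) (α β : Fin M → ℕ) :
    ordProd t α * ordProd t β =
      (-1) ^ (∑ a, ∑ b, if b < a then e a b * (α a * β b) else 0) * ordProd t (α + β) := by
  induction M with
  | zero => simp [ordProd]
  | succ M ih =>
    have h0 := (ordProd_skewCommute (t := fun a : Fin M => t a.succ)
      (fun a => h a.succ 0 (Fin.succ_pos a)) fun a => α a.succ).pow_right (β 0)
    have h1 := ih (t := fun a : Fin M => t a.succ) (e := fun a b => e a.succ b.succ)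
      (fun a b hab => h a.succ b.succ (Fin.succ_lt_succ_iff.2 hab)) (fun a => α a.succ)
      fun a => β a.succ
    unfold SkewCommute at h0
    rw [ordProd_succ t α, ordProd_succ t β, mul_assoc, ← mul_assoc (ordProd _ _), h0, mul_assoc,
      mul_assoc, h1, ordProd_succ t (α + β), Fin.sum_univ_succ]
    simp only [Fin.sum_univ_succ (n := M), Fin.succ_pos, if_true, Fin.succ_lt_succ_iff,
      Fin.not_lt_zero, if_false, Finset.sum_const_zero, Finset.sum_add_distrib, zero_add,
      Pi.add_apply, pow_add]
    rw [← mul_assoc (t 0 ^ α 0), neg_one_pow_commute, ← mul_assoc (t 0 ^ β 0), neg_one_pow_commute,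
      Finset.sum_mul, Finset.sum_congr rfl fun a _ => mul_assoc (e a.succ 0) (α a.succ) (β 0)]
    simp only [mul_assoc]
    rw [← mul_assoc (t 0 ^ α 0) ((-1) ^ _), neg_one_pow_commute]
    simp only [mul_assoc]
    rfl

theorem ordProd_eq_zero {M : ℕ} {t : Fin M → A} {α : Fin M → ℕ} {a : Fin M}
    (h : t a * t a = 0) (hα : 2 ≤ α a) : ordProd t α = 0 := by
  refine List.prod_eq_zero ((List.mem_ofFn' _ _).2 ⟨a, ?_⟩)
  obtain ⟨k, hk⟩ := Nat.exists_eq_add_of_le hα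
  change t a ^ α a = 0
  rw [hk, pow_add, pow_two, h, zero_mul]

end Skew

/-! ### The order filtration and the grading -/

namespace GSeries

variable {I : Type*} [NonUnitalCommSemiring I] {p : I →+ ZMod 2} {N : ℕ} {deg : Fin N → I}
  {R : Type*} [CommRing R] [Algebra ℝ R]

theorem coeff_neg (β : Fin N →₀ ℕ) (f : GSeries p deg R) : coeff β (-f) = -coeff β f := by
  rw [eq_neg_iff_add_eq_zero, ← coeff_add, neg_add_cancel, coeff_zero]

theorem coeff_sub (β : Fin N →₀ ℕ) (f g : GSeries p deg R) :
    coeff β (f - g) = coeff β f - coeff β g := by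
  rw [sub_eq_add_neg, coeff_add, coeff_neg, sub_eq_add_neg]

/-- `coeff β` as a linear map. -/
def coeffₗ (β : Fin N →₀ ℕ) : GSeries p deg R →ₗ[ℝ] R where
  toFun := coeff β
  map_add' := coeff_add β
  map_smul' := coeff_smul β

theorem coeff_sum {κ : Type*} (s : Finset κ) (f : κ → GSeries p deg R) (β : Fin N →₀ ℕ) :
    coeff β (∑ k ∈ s, f k) = ∑ k ∈ s, coeff β (f k) :=
  map_sum (coeffₗ (p := p) (deg := deg) (R := R) β) f s

theorem coeff_mul_eq {γ : Fin N →₀ ℕ} (f g : GSeries p deg R) (r : R)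
    (h : Adm p deg γ → ∑ q ∈ Finset.HasAntidiagonal.antidiagonal γ,
      (-1 : R) ^ swaps p deg q.1 q.2 * (coeff q.1 f * coeff q.2 g) = r)
    (h' : ¬ Adm p deg γ → r = 0) : coeff γ (f * g) = r := by
  by_cases hγ : Adm p deg γ
  · rw [coeff_mul hγ, h hγ]
  · rw [coeff_of_not_adm hγ, h' hγ]

variable (p deg R) in
/-- The series without terms of order less than `k`. -/
def filt (k : ℕ) : Submodule ℝ (GSeries p deg R) where
  carrier := {f | ∀ β, wt β < k → coeff β f = 0}
  add_mem' hf hg β hβ := by rw [coeff_add, hf β hβ, hg β hβ, add_zero]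
  zero_mem' β _ := coeff_zero β
  smul_mem' r f hf β hβ := by rw [coeff_smul, hf β hβ, smul_zero]

theorem filt_zero (f : GSeries p deg R) : f ∈ filt p deg R 0 := fun _ h => absurd h (by simp)

theorem filt_anti {j k : ℕ} (h : j ≤ k) {f : GSeries p deg R} (hf : f ∈ filt p deg R k) :
    f ∈ filt p deg R j := fun β hβ => hf β (hβ.trans_le h)

theorem eq_zero_of_forall_filt {f : GSeries p deg R} (h : ∀ k, f ∈ filt p deg R k) : f = 0 :=
  ext_coeff fun β _ => by rw [h (wt β + 1) β (Nat.lt_succ_self _), coeff_zero]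

theorem filt_one {f : GSeries p deg R} : f ∈ filt p deg R 1 ↔ body f = 0 := by
  refine ⟨fun h => h 0 (by simp [wt_zero]), fun h β hβ => ?_⟩
  rw [wt_eq_zero.1 (Nat.lt_one_iff.1 hβ)]
  exact h

theorem filt_mul {j k : ℕ} {f g : GSeries p deg R} (hf : f ∈ filt p deg R j)
    (hg : g ∈ filt p deg R k) : f * g ∈ filt p deg R (j + k) := by
  intro γ hγ
  refine coeff_mul_eq _ _ _ (fun _ => Finset.sum_eq_zero fun q hq => ?_) fun _ => rfl
  rw [← Finset.HasAntidiagonal.mem_antidiagonal.1 hq, wt_add] at hγ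
  rcases lt_or_ge (wt q.1) j with h | h
  · rw [hf _ h, zero_mul, mul_zero]
  · rw [hg _ (by omega), mul_zero, mul_zero]

theorem filt_mul_left {k : ℕ} (f : GSeries p deg R) {g : GSeries p deg R}
    (hg : g ∈ filt p deg R k) : f * g ∈ filt p deg R k := by
  simpa using filt_mul (filt_zero f) hg

theorem filt_mul_right {k : ℕ} {f : GSeries p deg R} (hf : f ∈ filt p deg R k)
    (g : GSeries p deg R) : f * g ∈ filt p deg R k := by
  simpa using filt_mul hf (filt_zero g)

variable (p deg R) in
/-- The embedding of the coefficients. -/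
def constHom : R →ₐ[ℝ] GSeries p deg R :=
  AlgHom.ofLinearMap
    { toFun := const
      map_add' := fun r s => ext_coeff fun β _ => by
        simp only [coeff_add, coeff_const]; split_ifs <;> simp
      map_smul' := fun r s => ext_coeff fun β _ => by
        simp only [coeff_smul, coeff_const, RingHom.id_apply]; split_ifs <;> simp }
    rfl
    fun r s => ext_coeff fun β _ => by
      change coeff β (const (r * s)) = coeff β (const r * const s)
      rw [coeff_const_mul]
      simp only [coeff_const]; split_ifs <;> simp

theorem constHom_apply (r : R) : constHom p deg R r = const r := rfl

theorem const_mul (r s : R) :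
    (const (r * s) : GSeries p deg R) = const r * const s := map_mul (constHom p deg R) r s

variable (p deg R) in
/-- The body map as an algebra homomorphism. -/
def bodyHom : GSeries p deg R →ₐ[ℝ] R :=
  AlgHom.ofLinearMap (coeffₗ 0)
    (by
      change coeff 0 (const (1 : R) : GSeries p deg R) = 1
      rw [coeff_const, if_pos rfl])
    fun f g => by
      change coeff 0 (f * g) = coeff 0 f * coeff 0 g
      rw [coeff_mul adm_zero]
      simp [swaps_zero_left]

theorem bodyHom_apply (f : GSeries p deg R) : bodyHom p deg R f = body f := rfl

theorem body_mul (f g : GSeries p deg R) : body (f * g) = body f * body g :=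
  map_mul (bodyHom p deg R) f g

theorem body_sub (f g : GSeries p deg R) : body (f - g) = body f - body g :=
  map_sub (bodyHom p deg R) f g

theorem body_const (r : R) : body (const r : GSeries p deg R) = r := by
  rw [body, coeff_const, if_pos rfl]

theorem sub_const_body_mem (f : GSeries p deg R) : f - const (body f) ∈ filt p deg R 1 := by
  rw [filt_one, body_sub, body_const, sub_self]

/-- Replacing `f` by its body changes the product only in order greater than wt γ. Thus leading
coefficients are multiplied by functions. -/
theorem coeff_mul_of_mem_filt (f : GSeries p deg R) {g : GSeries p deg R} {γ : Fin N →₀ ℕ}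
    (hg : g ∈ filt p deg R (wt γ)) : coeff γ (f * g) = body f * coeff γ g := by
  have h := filt_mul (sub_const_body_mem f) hg γ (by omega)
  rw [sub_mul, coeff_sub, coeff_const_mul, sub_eq_zero] at h
  exact h

/-! #### Single terms -/

open Classical in
/-- The series `r θ^β`. -/
def single (β : Fin N →₀ ℕ) (r : R) : GSeries p deg R := fun γ => if γ.1 = β then r else 0

open Classical in
theorem coeff_single {γ : Fin N →₀ ℕ} (h : Adm p deg γ) (β : Fin N →₀ ℕ) (r : R) :
    coeff γ (single β r : GSeries p deg R) = if γ = β then r else 0 := by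
  rw [coeff_of_adm h]; rfl

theorem coeff_single_of_ne {γ β : Fin N →₀ ℕ} (h : γ ≠ β) (r : R) :
    coeff γ (single β r : GSeries p deg R) = 0 := by
  by_cases hγ : Adm p deg γ
  · rw [coeff_single hγ, if_neg h]
  · exact coeff_of_not_adm hγ _

theorem coeff_single_self {β : Fin N →₀ ℕ} (h : Adm p deg β) (r : R) :
    coeff β (single β r : GSeries p deg R) = r := by rw [coeff_single h, if_pos rfl]

theorem single_of_not_adm {β : Fin N →₀ ℕ} (h : ¬ Adm p deg β) (r : R) :
    (single β r : GSeries p deg R) = 0 :=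
  ext_coeff fun γ hγ => by
    rw [coeff_zero, coeff_single_of_ne]
    rintro rfl
    exact h hγ

theorem single_mem_filt (β : Fin N →₀ ℕ) (r : R) : single β r ∈ filt p deg R (wt β) := by
  intro γ hγ
  refine coeff_single_of_ne ?_ _
  rintro rfl
  exact lt_irrefl _ hγ

theorem coeff_mul_single {δ β : Fin N →₀ ℕ} (h : Adm p deg (δ + β)) (f : GSeries p deg R) (r : R) :
    coeff (δ + β) (f * single β r) = (-1) ^ swaps p deg δ β * (coeff δ f * r) := by
  rw [coeff_mul h, Finset.sum_eq_single (δ, β)]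
  · rw [coeff_single_self (h.of_le le_add_self)]
  · rintro ⟨a, b⟩ hq hne
    rw [coeff_single_of_ne, mul_zero, mul_zero]
    rintro rfl
    exact hne (by simpa using hq)
  · intro hn
    exact absurd (by simp) hn

theorem coeff_mul_single_of_not_le {γ β : Fin N →₀ ℕ} (h : ¬ β ≤ γ) (f : GSeries p deg R) (r : R) :
    coeff γ (f * single β r) = 0 := by
  refine coeff_mul_eq _ _ _ (fun _ => Finset.sum_eq_zero fun q hq => ?_) fun _ => rfl
  rw [coeff_single_of_ne, mul_zero, mul_zero]
  rintro e
  apply h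
  rw [← e, ← Finset.HasAntidiagonal.mem_antidiagonal.1 hq]
  exact le_add_self

theorem single_mul_single (α β : Fin N →₀ ℕ) (r s : R) :
    (single α r * single β s : GSeries p deg R) =
      single (α + β) ((-1) ^ swaps p deg α β * (r * s)) := by
  refine ext_coeff fun γ hγ => ?_
  by_cases h : β ≤ γ
  · obtain ⟨δ, rfl⟩ : ∃ δ, γ = δ + β := ⟨γ - β, (tsub_add_cancel_of_le h).symm⟩
    rw [coeff_mul_single hγ, coeff_single hγ, coeff_single (hγ.of_le le_self_add)]
    by_cases e : δ = α
    · subst e; simp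
    · simp [e]
  · rw [coeff_mul_single_of_not_le h, coeff_single_of_ne]
    rintro rfl
    exact h le_add_self

/-- The variable `θ_a`. -/
def var (a : Fin N) : GSeries p deg R := single (Finsupp.single a 1) 1

theorem var_mem_filt (a : Fin N) : var a ∈ filt p deg R 1 := by
  have h := single_mem_filt (p := p) (deg := deg) (Finsupp.single a 1) (1 : R)
  rwa [wt_single] at h

theorem sub_sum_single_mem (f : GSeries p deg R) (K : ℕ) :
    f - ∑ β ∈ (finite_wt_lt N K).toFinset, single β (coeff β f) ∈ filt p deg R K := by
  intro γ hγ
  rw [coeff_sub, coeff_sum, Finset.sum_eq_single γ, sub_eq_zero]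
  · by_cases h : Adm p deg γ
    · rw [coeff_single_self h]
    · simp [coeff_of_not_adm h]
  · exact fun β _ hβ => coeff_single_of_ne hβ.symm _
  · exact fun h => absurd ((finite_wt_lt N K).mem_toFinset.2 hγ) h

/-- To prove an additive statement modulo terms of high order, it suffices to treat single terms. -/
theorem induction_filt {P : GSeries p deg R → Prop} (K : ℕ) (hadd : ∀ f g, P f → P g → P (f + g))
    (hsingle : ∀ β r, P (single β r)) (hfilt : ∀ f ∈ filt p deg R K, P f)
    (f : GSeries p deg R) : P f := by
  have hsum : ∀ s : Finset (Fin N →₀ ℕ), P (∑ β ∈ s, single β (coeff β f)) := fun s =>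
    Finset.sum_induction _ P hadd (hfilt 0 (zero_mem _)) fun β _ => hsingle _ _
  have h := hadd _ _ (hfilt _ (sub_sum_single_mem f K)) (hsum (finite_wt_lt N K).toFinset)
  rwa [sub_add_cancel] at h

/-- Each monomial is assigned to the variable of largest index that it contains. This variable
stands last in the ordered monomial, so it splits off on the right without a sign. -/
theorem exists_eq_sum_mul_var {k : ℕ} {f : GSeries p deg R} (hf : f ∈ filt p deg R (k + 1)) :
    ∃ h : Fin N → GSeries p deg R, (∀ b, h b ∈ filt p deg R k) ∧ f = ∑ b, h b * var b := by
  classical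
  let h : Fin N → GSeries p deg R := fun b α =>
    if ∀ a, b < a → α.1 a = 0 then coeff (α.1 + Finsupp.single b 1) f else 0
  have hh : ∀ b α, Adm p deg α → coeff α (h b) =
      if ∀ a, b < a → α a = 0 then coeff (α + Finsupp.single b 1) f else 0 := by
    intro b α hα
    rw [coeff_of_adm hα]
  refine ⟨h, fun b α hα => ?_, ext_coeff fun γ hγ => ?_⟩
  · by_cases had : Adm p deg α
    · rw [hh b α had]
      split_ifs
      · exact hf _ (by rw [wt_add, wt_single]; omega)
      · rfl
    · exact coeff_of_not_adm had _
  · rw [coeff_sum]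
    by_cases h0 : γ = 0
    · subst h0
      rw [hf 0 (by simp [wt_zero])]
      refine (Finset.sum_eq_zero fun b _ => ?_).symm
      exact filt_mul_left _ (var_mem_filt b) 0 (by simp [wt_zero])
    · have hne : γ.support.Nonempty := Finsupp.support_nonempty_iff.2 h0
      obtain ⟨m, hm, hmax⟩ := γ.support.exists_max_image id hne
      have hm' : ∀ a, m < a → γ a = 0 := fun a ha => by
        by_contra hc
        exact absurd (hmax a (Finsupp.mem_support_iff.2 hc)) (not_le.2 ha)
      rw [Finset.sum_eq_single m]
      · obtain ⟨δ, rfl⟩ : ∃ δ, γ = δ + Finsupp.single m 1 :=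
          ⟨γ - Finsupp.single m 1, (tsub_add_cancel_of_le (by
            simpa [Nat.one_le_iff_ne_zero] using hm)).symm⟩
        have hδ : ∀ a, m < a → δ a = 0 := fun a ha => by
          have := hm' a ha
          rw [Finsupp.add_apply] at this
          omega
        have hs : swaps p deg δ (Finsupp.single m 1) = 0 := by
          refine Finset.sum_eq_zero fun a _ => Finset.sum_eq_zero fun b _ => ?_
          split_ifs with hab
          · by_cases hb : m = b
            · subst hb
              rw [hδ a hab.1, zero_mul]
            · simp [Ne.symm hb]
          · rfl
        rw [var, coeff_mul_single hγ, hh m δ (hγ.of_le le_self_add), if_pos hδ, hs]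
        simp
      · intro b _ hb
        by_cases hle : Finsupp.single b 1 ≤ γ
        · obtain ⟨δ, rfl⟩ : ∃ δ, γ = δ + Finsupp.single b 1 :=
            ⟨γ - Finsupp.single b 1, (tsub_add_cancel_of_le hle).symm⟩
          rw [var, coeff_mul_single hγ, hh b δ (hγ.of_le le_self_add), if_neg, zero_mul, mul_zero]
          intro hc
          have hbm : b ≤ m := hmax b (by simp)
          have := hc m (lt_of_le_of_ne hbm hb)
          rw [Finsupp.mem_support_iff, Finsupp.add_apply, this] at hm
          simp [hb] at hm
        · exact coeff_mul_single_of_not_le hle _ _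
      · simp

/-! #### Completeness -/

/-- Successive approximation: the remainder after k corrections has order k, and the next correction
is chosen for it. The corrections have increasing order, so their sum is a well-defined series. -/
theorem surjective_of_filt {p' : I →+ ZMod 2} {M : ℕ} {deg' : Fin M → I} {S : Type*} [CommRing S]
    [Algebra ℝ S] (Φ : GSeries p' deg' S →+ GSeries p deg R)
    (h1 : ∀ k, ∀ c ∈ filt p' deg' S k, Φ c ∈ filt p deg R k)
    (h2 : ∀ k, ∀ f ∈ filt p deg R k, ∃ c ∈ filt p' deg' S k, f - Φ c ∈ filt p deg R (k + 1)) :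
    Function.Surjective Φ := by
  intro f
  choose! s hs hs' using h2
  let r : ∀ k, {f // f ∈ filt p deg R k} := fun k =>
    Nat.rec ⟨f, filt_zero f⟩ (fun k f => ⟨f.1 - Φ (s k f.1), hs' k f.1 f.2⟩) k
  let c : ℕ → GSeries p' deg' S := fun k => s k (r k).1
  have hc : ∀ k, c k ∈ filt p' deg' S k := fun k => hs k _ (r k).2
  have hr : ∀ K, (r K).1 = f - Φ (∑ k ∈ Finset.range K, c k) := by
    intro K
    induction K with
    | zero => simp [r]
    | succ K ih =>
      rw [Finset.sum_range_succ, map_add, ← sub_sub, ← ih]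
  -- Since `c k` has no terms of order below `k`, only the indices k ≤ wt β contribute to the
  -- coefficient at β.
  let C : GSeries p' deg' S := fun β => ∑ k ∈ Finset.range (wt β.1 + 1), coeff β.1 (c k)
  have hC : ∀ K, C - ∑ k ∈ Finset.range K, c k ∈ filt p' deg' S K := by
    intro K β hβ
    rw [coeff_sub, coeff_sum, sub_eq_zero]
    by_cases had : Adm p' deg' β
    · rw [coeff_of_adm had]
      refine Finset.sum_subset (Finset.range_subset_range.2 hβ) fun k _ hk => hc k β ?_
      exact Nat.lt_of_succ_le (not_lt.1 fun h => hk (Finset.mem_range.2 h))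
    · simp [coeff_of_not_adm had]
  refine ⟨C, (sub_eq_zero.1 (eq_zero_of_forall_filt fun K => ?_)).symm⟩
  have h : (r K).1 - Φ (C - ∑ k ∈ Finset.range K, c k) ∈ filt p deg R K :=
    Submodule.sub_mem _ (r K).2 (h1 K _ (hC K))
  rw [hr K, map_sub] at h
  simpa using h

/-- The inverse of the body inverts `f` modulo order 1, so left and right multiplication by `f` are
both surjective by approximation. Both are treated because the ring is not commutative; the two
one-sided inverses then coincide. -/
theorem isUnit_of_body {f : GSeries p deg R} (h : IsUnit (body f)) : IsUnit f := by
  obtain ⟨u, hu⟩ := h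
  have hbr : body f * (↑u⁻¹ : R) = 1 := by rw [← hu, Units.mul_inv]
  have e1 : 1 - f * const (↑u⁻¹ : R) ∈ filt p deg R 1 := by
    rw [filt_one, body_sub, body_mul, body_const, hbr, ← bodyHom_apply, map_one, sub_self]
  have e2 : 1 - const (↑u⁻¹ : R) * f ∈ filt p deg R 1 := by
    rw [filt_one, body_sub, body_mul, body_const, mul_comm, hbr, ← bodyHom_apply, map_one, sub_self]
  obtain ⟨g, hg⟩ := surjective_of_filt (AddMonoidHom.mulLeft f)
    (fun k c hc => filt_mul_left f hc) (fun k c hc => ⟨const (↑u⁻¹ : R) * c, filt_mul_left _ hc, by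
      have := filt_mul e1 hc
      rw [sub_mul, one_mul, mul_assoc] at this
      simpa [add_comm] using this⟩) 1
  obtain ⟨g', hg'⟩ := surjective_of_filt (AddMonoidHom.mulRight f)
    (fun k c hc => filt_mul_right hc f) (fun k c hc => ⟨c * const (↑u⁻¹ : R), filt_mul_right hc _, by
      have := filt_mul hc e2
      rw [mul_sub, mul_one, ← mul_assoc] at this
      exact this⟩) 1
  change f * g = 1 at hg
  change g' * f = 1 at hg'
  have : g' = g := by rw [← mul_one g', ← hg, ← mul_assoc, hg', one_mul]
  exact ⟨⟨f, g, hg, by rw [← this, hg']⟩, rfl⟩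

/-! #### Homogeneous elements -/

theorem mem_homog {i : I} {f : GSeries p deg R} :
    f ∈ homog p deg R i ↔ ∀ β, coeff β f ≠ 0 → degOf deg β = i := Iff.rfl

theorem const_mem_homog (r : R) : const r ∈ homog p deg R 0 := by
  intro β hβ
  rw [coeff_const] at hβ
  have : β = 0 := by by_contra h; simp [h] at hβ
  subst this
  exact degOf_zero

theorem one_mem_homog : (1 : GSeries p deg R) ∈ homog p deg R 0 := const_mem_homog 1

theorem var_mem_homog (a : Fin N) : var a ∈ homog p deg R (deg a) := by
  intro β hβ
  by_cases h : β = Finsupp.single a 1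
  · subst h; exact degOf_single a
  · exact absurd (coeff_single_of_ne h _) hβ

theorem mul_mem_homog {i j : I} {f g : GSeries p deg R} (hf : f ∈ homog p deg R i)
    (hg : g ∈ homog p deg R j) : f * g ∈ homog p deg R (i + j) := by
  intro γ hγ
  by_contra hne
  refine hγ (coeff_mul_eq _ _ _ (fun _ => Finset.sum_eq_zero fun q hq => ?_) fun _ => rfl)
  by_contra hq0
  apply hne
  have h1 : coeff q.1 f ≠ 0 := fun h => hq0 (by rw [h, zero_mul, mul_zero])
  have h2 : coeff q.2 g ≠ 0 := fun h => hq0 (by rw [h, mul_zero, mul_zero])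
  change degOf deg γ = _
  rw [← Finset.HasAntidiagonal.mem_antidiagonal.1 hq, degOf_add, mem_homog.1 hf _ h1,
    mem_homog.1 hg _ h2]

theorem pow_mem_homog {i : I} {f : GSeries p deg R} (hf : f ∈ homog p deg R i) (k : ℕ) :
    f ^ k ∈ homog p deg R (k • i) := by
  induction k with
  | zero => simpa using one_mem_homog
  | succ k ih => rw [pow_succ, succ_nsmul]; exact mul_mem_homog ih hf

theorem body_eq_zero_of_mem_homog {i : I} (hi : i ≠ 0) {f : GSeries p deg R}
    (hf : f ∈ homog p deg R i) : body f = 0 := by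
  by_contra h
  exact hi ((mem_homog.1 hf 0 h).symm.trans degOf_zero)

/-- The condition concerns only pairs of terms that actually occur. It therefore covers two
homogeneous factors and also a factor of degree 0 against an arbitrary, inhomogeneous one. -/
theorem skewCommute_of_parity {f g : GSeries p deg R} {e : ZMod 2}
    (h : ∀ α β, coeff α f ≠ 0 → coeff β g ≠ 0 → p (degOf deg α * degOf deg β) = e) :
    SkewCommute e.val f g := by
  have hc : ((-1 : GSeries p deg R) ^ e.val) = const ((-1) ^ e.val) := by
    rw [← constHom_apply, map_pow, map_neg, map_one]
  refine ext_coeff fun γ hγ => ?_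
  rw [hc, coeff_const_mul, coeff_mul hγ, coeff_mul hγ, Finset.mul_sum]
  refine Finset.sum_equiv (Equiv.prodComm _ _) (fun q => ?_) fun q hq => ?_
  · simp [add_comm]
  · change _ = (-1) ^ e.val * ((-1) ^ swaps p deg q.2 q.1 * (coeff q.2 g * coeff q.1 f))
    by_cases h1 : coeff q.1 f = 0
    · simp [h1]
    by_cases h2 : coeff q.2 g = 0
    · simp [h2]
    rw [neg_one_pow_swaps_comm (by rwa [Finset.HasAntidiagonal.mem_antidiagonal.1 hq]), h _ _ h1 h2,
      mul_comm (coeff q.2 g), mul_assoc]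

theorem skewCommute_of_mem_homog {i j : I} {f g : GSeries p deg R} (hf : f ∈ homog p deg R i)
    (hg : g ∈ homog p deg R j) : SkewCommute (p (i * j)).val f g :=
  skewCommute_of_parity fun α β h1 h2 => by rw [mem_homog.1 hf α h1, mem_homog.1 hg β h2]

theorem mul_comm_of_mem_homog_zero {f : GSeries p deg R} (hf : f ∈ homog p deg R 0)
    (g : GSeries p deg R) : f * g = g * f := by
  have h : SkewCommute (0 : ZMod 2).val f g :=
    skewCommute_of_parity fun α β h1 _ => by rw [mem_homog.1 hf α h1, zero_mul, map_zero]
  simpa [SkewCommute] using h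

/-- Skew-commutation gives f² = -f², and 2 is invertible. -/
theorem mul_self_eq_zero_of_odd {i : I} (hi : p (i * i) = 1) {f : GSeries p deg R}
    (hf : f ∈ homog p deg R i) : f * f = 0 := by
  have h := skewCommute_of_mem_homog hf hf
  rw [hi, SkewCommute, ZMod.val_one, pow_one, neg_one_mul] at h
  have h2 : (2 : ℝ) • (f * f) = 0 := by rw [two_smul]; exact add_eq_zero_iff_eq_neg.2 h
  exact (smul_eq_zero.1 h2).resolve_left two_ne_zero

/-! #### Monomials -/

theorem monomial_eq_ordProd {M : ℕ} (t : Fin M → GSeries p deg R) (β : Fin M → ℕ) :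
    monomial t β = ordProd t β := rfl

theorem monomial_mem_filt {M : ℕ} {t : Fin M → GSeries p deg R} (ht : ∀ a, t a ∈ filt p deg R 1)
    (β : Fin M → ℕ) : monomial t β ∈ filt p deg R (∑ a, β a) := by
  rw [monomial_eq_ordProd]
  induction M with
  | zero => exact filt_zero _
  | succ M ih =>
    rw [ordProd_succ, Fin.sum_univ_succ]
    refine filt_mul ?_ (ih (fun a => ht a.succ) _)
    induction β 0 with
    | zero => exact filt_zero _
    | succ k ihk => rw [pow_succ]; exact filt_mul ihk (ht 0)

theorem monomial_mem_homog {M : ℕ} {t : Fin M → GSeries p deg R} {d : Fin M → I}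
    (ht : ∀ a, t a ∈ homog p deg R (d a)) (β : Fin M → ℕ) :
    monomial t β ∈ homog p deg R (∑ a, β a • d a) := by
  rw [monomial_eq_ordProd]
  induction M with
  | zero => simpa [ordProd] using one_mem_homog
  | succ M ih =>
    rw [ordProd_succ, Fin.sum_univ_succ]
    exact mul_mem_homog (pow_mem_homog (ht 0) _) (ih (fun a => ht a.succ) _)

theorem monomial_eq_zero {M : ℕ} {t : Fin M → GSeries p deg R} {d : Fin M → I}
    (ht : ∀ a, t a ∈ homog p deg R (d a)) {β : Fin M →₀ ℕ} (h : ¬ Adm p d β) :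
    monomial t β = 0 := by
  unfold Adm at h
  push Not at h
  obtain ⟨a, ha, hβ⟩ := h
  exact ordProd_eq_zero (mul_self_eq_zero_of_odd ha (ht a)) hβ

/-- The sign is the one in the multiplication of the series ring itself, which is what makes
substitution multiplicative. -/
theorem monomial_mul_monomial {M : ℕ} {t : Fin M → GSeries p deg R} {d : Fin M → I}
    (ht : ∀ a, t a ∈ homog p deg R (d a)) (α β : Fin M →₀ ℕ) :
    monomial t α * monomial t β = (-1) ^ swaps p d α β * monomial t (α + β : Fin M →₀ ℕ) := by
  rw [monomial_eq_ordProd, monomial_eq_ordProd, ordProd_mul (e := fun a b => (p (d a * d b)).val)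
    fun a b _ => skewCommute_of_mem_homog (ht a) (ht b)]
  congr 2
  rw [swaps]
  refine Finset.sum_congr rfl fun a _ => Finset.sum_congr rfl fun b _ => ?_
  have h3 : ∀ z : ZMod 2, z.val = if z = 1 then 1 else 0 := by decide
  rw [h3]
  by_cases h1 : b < a <;> by_cases h2 : p (d a * d b) = 1 <;> simp [h1, h2]

theorem monomial_single {M : ℕ} (t : Fin M → GSeries p deg R) (a : Fin M) :
    monomial t (Finsupp.single a 1 : Fin M →₀ ℕ) = t a := by
  rw [monomial_eq_ordProd]
  induction M with
  | zero => exact a.elim0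
  | succ M ih =>
    rw [ordProd_succ]
    refine Fin.cases ?_ (fun b => ?_) a
    · rw [show (fun b : Fin M => (Finsupp.single (0 : Fin (M + 1)) 1 : Fin (M + 1) →₀ ℕ) b.succ) = 0
        from funext fun b => by simp]
      simp [ordProd]
    · rw [show (fun c : Fin M => (Finsupp.single b.succ 1 : Fin (M + 1) →₀ ℕ) c.succ) =
        (Finsupp.single b 1 : Fin M →₀ ℕ) from funext fun c => by
          simp [Finsupp.single_apply], ih]
      simp

end GSeries

/-! ### Substitution into formal power series -/

namespace GSeries

variable {I : Type*} [NonUnitalCommSemiring I] {p : I →+ ZMod 2} {N : ℕ} {deg : Fin N → I}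
  {R : Type*} [CommRing R] [Algebra ℝ R]

theorem IsFormalSum.unique {κ : Type*} {s : κ → GSeries p deg R} {f g : GSeries p deg R}
    (hf : IsFormalSum s f) (hg : IsFormalSum s g) : f = g :=
  ext_coeff fun β _ => (hf β).2.trans (hg β).2.symm

theorem IsFormalSum.add {κ : Type*} {s t : κ → GSeries p deg R} {f g : GSeries p deg R}
    (hf : IsFormalSum s f) (hg : IsFormalSum t g) : IsFormalSum (fun k => s k + t k) (f + g) := by
  intro β
  simp only [coeff_add]
  refine ⟨((hf β).1.union (hg β).1).subset (Function.support_add _ _), ?_⟩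
  rw [(hf β).2, (hg β).2, finsum_add_distrib (hf β).1 (hg β).1]

theorem IsFormalSum.smul {κ : Type*} {s : κ → GSeries p deg R} {f : GSeries p deg R}
    (hf : IsFormalSum s f) (r : ℝ) : IsFormalSum (fun k => r • s k) (r • f) := by
  intro β
  simp only [coeff_smul]
  refine ⟨(hf β).1.subset fun k hk h => hk (by simp only [h, smul_zero]), ?_⟩
  rw [(hf β).2, smul_finsum' r (hf β).1]

omit [Algebra ℝ R] in
theorem IsFormalSum.coeff_eq_zero {κ : Type*} {s : κ → GSeries p deg R} {f : GSeries p deg R}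
    (hf : IsFormalSum s f) {β : Fin N →₀ ℕ} (h : ∀ k, coeff β (s k) = 0) : coeff β f = 0 := by
  rw [(hf β).2]
  simp [h]

theorem IsFormalSum.eq_single {κ : Type*} {s : κ → GSeries p deg R} {f : GSeries p deg R}
    (hf : IsFormalSum s f) (k : κ) (h : ∀ l, l ≠ k → s l = 0) : f = s k :=
  ext_coeff fun β _ => by
    rw [(hf β).2, finsum_eq_single _ k fun l hl => by rw [h l hl, coeff_zero]]

theorem coeff_map {S : Type*} [CommRing S] [Algebra ℝ S] (v : R →ₐ[ℝ] S) (β : Fin N →₀ ℕ)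
    (f : GSeries p deg R) : coeff β (map v f) = v (coeff β f) := by
  by_cases h : Adm p deg β
  · rw [coeff_of_adm h, coeff_of_adm h]
    rfl
  · rw [coeff_of_not_adm h, coeff_of_not_adm h, map_zero]

theorem IsFormalSum.map {κ : Type*} {s : κ → GSeries p deg R} {f : GSeries p deg R}
    (hf : IsFormalSum s f) {S : Type*} [CommRing S] [Algebra ℝ S] (v : R →ₐ[ℝ] S) :
    IsFormalSum (fun k => map v (s k)) (map v f) := by
  intro β
  simp only [coeff_map]
  refine ⟨(hf β).1.subset fun k hk h => hk (by simp only [h, map_zero]), ?_⟩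
  rw [(hf β).2]
  exact v.toAddMonoidHom.map_finsum (hf β).1

theorem map_mem_homog {S : Type*} [CommRing S] [Algebra ℝ S] (v : R →ₐ[ℝ] S) {i : I}
    {f : GSeries p deg R} (hf : f ∈ homog p deg R i) : map v f ∈ homog p deg S i := by
  intro β hβ
  refine hf β fun h => hβ ?_
  rw [coeff_map, h, map_zero]

theorem map_mem_filt {S : Type*} [CommRing S] [Algebra ℝ S] (v : R →ₐ[ℝ] S) {k : ℕ}
    {f : GSeries p deg R} (hf : f ∈ filt p deg R k) : map v f ∈ filt p deg S k := by
  intro β hβ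
  rw [coeff_map, hf β hβ, map_zero]

theorem body_map {S : Type*} [CommRing S] [Algebra ℝ S] (v : R →ₐ[ℝ] S)
    (f : GSeries p deg R) : body (map v f) = v (body f) := coeff_map v 0 f

theorem map_const {S : Type*} [CommRing S] [Algebra ℝ S] (v : R →ₐ[ℝ] S) (r : R) :
    map v (const r : GSeries p deg R) = const (v r) :=
  ext_coeff fun β _ => by
    rw [coeff_map, coeff_const, coeff_const]
    split_ifs <;> simp

theorem map_var {S : Type*} [CommRing S] [Algebra ℝ S] (v : R →ₐ[ℝ] S) (a : Fin N) :
    map v (var a : GSeries p deg R) = var a :=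
  ext_coeff fun β hβ => by
    rw [coeff_map, var, var, coeff_single hβ, coeff_single hβ]
    split_ifs <;> simp

theorem map_monomial {S : Type*} [CommRing S] [Algebra ℝ S] (v : R →ₐ[ℝ] S) {M : ℕ}
    (t : Fin M → GSeries p deg R) (β : Fin M → ℕ) :
    map v (monomial t β) = monomial (fun a => map v (t a)) β := by
  rw [monomial, monomial, map_list_prod, List.map_ofFn]
  congr 2
  funext a
  exact map_pow _ _ _

/-! ### Evaluation of formal series at homogeneous elements. -/

section Eval

variable {S : Type*} [CommRing S] [Algebra ℝ S] {M : ℕ} {deg' : Fin M → I}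

/-- Conditions under which `∑ c_β θ^β ↦ ∑ u(c_β) ζ^β` is a homomorphism of algebras. -/
structure IsEvalData (deg' : Fin M → I) (u : R →ₐ[ℝ] GSeries p deg S)
    (ζ : Fin M → GSeries p deg S) : Prop where
  coeff_mem : ∀ r, u r ∈ homog p deg S 0
  var_mem : ∀ a, ζ a ∈ homog p deg S (deg' a)
  var_filt : ∀ a, ζ a ∈ filt p deg S 1

variable {u : R →ₐ[ℝ] GSeries p deg S} {ζ : Fin M → GSeries p deg S}

variable (u ζ) in
/-- The formal sum `∑ u(c_β) ζ^β`. -/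
def evalFun (c : GSeries p deg' R) : GSeries p deg S :=
  fun γ => ∑ᶠ β : {β : Fin M →₀ ℕ // Adm p deg' β}, coeff γ.1 (u (coeff β.1 c) * monomial ζ β.1)

/-- The term at β has order at least wt β, so only the finitely many β with wt β ≤ wt γ contribute
to the coefficient at γ. -/
theorem IsEvalData.isFormalSum (h : IsEvalData deg' u ζ) (c : GSeries p deg' R) :
    IsFormalSum (fun β : {β : Fin M →₀ ℕ // Adm p deg' β} => u (coeff β.1 c) * monomial ζ β.1)
      (evalFun u ζ c) := by
  intro γ
  refine ⟨?_, ?_⟩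
  · refine ((finite_wt_lt M (wt γ + 1)).preimage
      (f := fun β : {β : Fin M →₀ ℕ // Adm p deg' β} => β.1) Subtype.val_injective.injOn).subset
      fun β hβ => ?_
    by_contra hlt
    refine hβ (filt_mul_left _ (monomial_mem_filt h.var_filt β.1) γ ?_)
    exact Nat.lt_of_succ_le (not_lt.1 hlt)
  · by_cases hγ : Adm p deg γ
    · rw [coeff_of_adm hγ]; rfl
    · simp [coeff_of_not_adm hγ]

theorem IsEvalData.evalFun_single (h : IsEvalData deg' u ζ) (β : Fin M →₀ ℕ) (r : R) :
    evalFun u ζ (single β r : GSeries p deg' R) = u r * monomial ζ β := by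
  by_cases hβ : Adm p deg' β
  · rw [(h.isFormalSum (single β r)).eq_single ⟨β, hβ⟩ fun α hα => ?_]
    · rw [coeff_single_self hβ]
    · rw [coeff_single_of_ne fun e => hα (Subtype.ext e), map_zero, zero_mul]
  · rw [single_of_not_adm hβ, monomial_eq_zero h.var_mem hβ, mul_zero]
    refine ext_coeff fun γ _ => ?_
    rw [coeff_zero]
    refine (h.isFormalSum 0).coeff_eq_zero fun α => ?_
    rw [coeff_zero, map_zero, zero_mul, coeff_zero]

theorem IsEvalData.evalFun_filt (h : IsEvalData deg' u ζ) {k : ℕ} {c : GSeries p deg' R}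
    (hc : c ∈ filt p deg' R k) : evalFun u ζ c ∈ filt p deg S k := by
  intro γ hγ
  refine (h.isFormalSum c).coeff_eq_zero fun β => ?_
  rcases lt_or_ge (wt β.1) k with hβ | hβ
  · rw [hc _ hβ, map_zero, zero_mul, coeff_zero]
  · exact filt_mul_left _ (monomial_mem_filt h.var_filt β.1) γ (hγ.trans_le hβ)

theorem IsEvalData.evalFun_add (h : IsEvalData deg' u ζ) (c d : GSeries p deg' R) :
    evalFun u ζ (c + d) = evalFun u ζ c + evalFun u ζ d := by
  refine (h.isFormalSum (c + d)).unique ?_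
  have h' := (h.isFormalSum c).add (h.isFormalSum d)
  simp only [← add_mul, ← map_add, ← coeff_add] at h'
  exact h'

theorem IsEvalData.evalFun_smul (h : IsEvalData deg' u ζ) (r : ℝ) (c : GSeries p deg' R) :
    evalFun u ζ (r • c) = r • evalFun u ζ c := by
  refine (h.isFormalSum (r • c)).unique ?_
  have h' := (h.isFormalSum c).smul r
  simp only [← smul_mul_assoc, ← map_smul, ← coeff_smul] at h'
  exact h'

/-- The element u(s) has degree 0, hence is central and can be moved past ζ^α. The remaining signs
agree by `monomial_mul_monomial`. If α + β is not admissible, ζ^(α+β) = 0, in accordance with the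
source. -/
theorem IsEvalData.evalFun_single_mul (h : IsEvalData deg' u ζ) (α β : Fin M →₀ ℕ) (r s : R) :
    evalFun u ζ (single α r * single β s : GSeries p deg' R) =
      evalFun u ζ (single α r : GSeries p deg' R) *
        evalFun u ζ (single β s : GSeries p deg' R) := by
  rw [single_mul_single, h.evalFun_single, h.evalFun_single, h.evalFun_single, mul_assoc,
    ← mul_assoc (monomial ζ α), ← mul_comm_of_mem_homog_zero (h.coeff_mem s), mul_assoc (u s),
    monomial_mul_monomial h.var_mem, map_mul, map_mul, map_pow, map_neg, map_one]
  rw [← mul_assoc (u s) ((-1) ^ _), neg_one_pow_commute, ← mul_assoc (u r), ← mul_assoc (u r),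
    neg_one_pow_commute]
  simp only [mul_assoc]

/-- Modulo order K each factor is a finite sum of single terms, and evaluation respects the
filtration. So the identity follows from the case of single terms, one factor at a time. -/
theorem IsEvalData.evalFun_mul (h : IsEvalData deg' u ζ) (c d : GSeries p deg' R) :
    evalFun u ζ (c * d) = evalFun u ζ c * evalFun u ζ d := by
  refine sub_eq_zero.1 (eq_zero_of_forall_filt fun K => ?_)
  revert d
  refine induction_filt (P := fun c => ∀ d : GSeries p deg' R,
    evalFun u ζ (c * d) - evalFun u ζ c * evalFun u ζ d ∈ filt p deg S K) K ?_ ?_ ?_ c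
  · intro c c' hc hc' d
    rw [add_mul, h.evalFun_add, h.evalFun_add, add_mul, add_sub_add_comm]
    exact Submodule.add_mem _ (hc d) (hc' d)
  · intro α r d
    refine induction_filt (P := fun d => evalFun u ζ (single α r * d) -
      evalFun u ζ (single α r : GSeries p deg' R) * evalFun u ζ d ∈ filt p deg S K) K ?_ ?_ ?_ d
    · intro d d' hd hd'
      rw [mul_add, h.evalFun_add, h.evalFun_add, mul_add, add_sub_add_comm]
      exact Submodule.add_mem _ hd hd'
    · intro β s
      rw [h.evalFun_single_mul, sub_self]
      exact zero_mem _
    · intro d hd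
      exact Submodule.sub_mem _ (h.evalFun_filt (filt_mul_left _ hd))
        (filt_mul_left _ (h.evalFun_filt hd))
  · intro c hc d
    exact Submodule.sub_mem _ (h.evalFun_filt (filt_mul_right hc _))
      (filt_mul_right (h.evalFun_filt hc) _)

theorem IsEvalData.evalFun_const (h : IsEvalData deg' u ζ) (r : R) :
    evalFun u ζ (const r : GSeries p deg' R) = u r := by
  have h1 := h.evalFun_single 0 r
  have h2 : monomial ζ (0 : Fin M →₀ ℕ) = 1 := by simp [monomial]
  rw [h2, mul_one] at h1
  exact h1

theorem IsEvalData.evalFun_var (h : IsEvalData deg' u ζ) (a : Fin M) :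
    evalFun u ζ (var a : GSeries p deg' R) = ζ a := by
  rw [var, h.evalFun_single, map_one, one_mul, monomial_single]

/-- The homomorphism `∑ c_β θ^β ↦ ∑ u(c_β) ζ^β`. -/
def IsEvalData.evalHom (h : IsEvalData deg' u ζ) : GSeries p deg' R →ₐ[ℝ] GSeries p deg S :=
  AlgHom.ofLinearMap
    { toFun := evalFun u ζ
      map_add' := h.evalFun_add
      map_smul' := h.evalFun_smul }
    ((h.evalFun_const 1).trans (map_one u)) h.evalFun_mul

theorem IsEvalData.evalHom_apply (h : IsEvalData deg' u ζ) (c : GSeries p deg' R) :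
    h.evalHom c = evalFun u ζ c := rfl

/-- Substitution preserves all conditions on the degrees of the terms. -/
theorem IsEvalData.degree_of_coeff_ne_zero (h : IsEvalData deg' u ζ) {Q : I → Prop}
    {c : GSeries p deg' R} (hc : ∀ β, coeff β c ≠ 0 → Q (degOf deg' β)) {γ : Fin N →₀ ℕ}
    (hγ : coeff γ (h.evalHom c) ≠ 0) : Q (degOf deg γ) := by
  by_contra hQ
  refine hγ ((h.isFormalSum c).coeff_eq_zero fun β => ?_)
  by_contra hne
  have hm := mul_mem_homog (h.coeff_mem (coeff β.1 c)) (monomial_mem_homog h.var_mem β.1) γ hne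
  rw [zero_add] at hm
  apply hQ
  rw [show degOf deg γ = degOf deg' β.1 from hm]
  refine hc β.1 fun h0 => hne ?_
  rw [h0, map_zero, zero_mul, coeff_zero]

theorem IsEvalData.evalHom_mem_homog (h : IsEvalData deg' u ζ) {i : I} {c : GSeries p deg' R}
    (hc : c ∈ homog p deg' R i) : h.evalHom c ∈ homog p deg S i :=
  fun _ hγ => h.degree_of_coeff_ne_zero (Q := fun j => j = i) hc hγ

theorem IsEvalData.body_evalHom (h : IsEvalData deg' u ζ) (c : GSeries p deg' R) :
    body (h.evalHom c) = body (u (body c)) := by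
  have h1 := filt_one.1 (h.evalFun_filt (sub_const_body_mem c))
  rw [← h.evalHom_apply, map_sub, body_sub, h.evalHom_apply (const _), h.evalFun_const,
    sub_eq_zero] at h1
  exact h1

theorem IsEvalData.map_evalHom (h : IsEvalData deg' u ζ) {R' S' : Type*} [CommRing R']
    [Algebra ℝ R'] [CommRing S'] [Algebra ℝ S'] {u' : R' →ₐ[ℝ] GSeries p deg S'}
    {ζ' : Fin M → GSeries p deg S'} (h' : IsEvalData deg' u' ζ') (v : S →ₐ[ℝ] S')
    (w : R →ₐ[ℝ] R') (hu : ∀ r, u' (w r) = map v (u r)) (hζ : ∀ a, ζ' a = map v (ζ a))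
    (c : GSeries p deg' R) : h'.evalHom (map w c) = map v (h.evalHom c) := by
  obtain rfl : ζ' = fun a => map v (ζ a) := funext hζ
  refine (h'.isFormalSum (map w c)).unique ?_
  have h1 := (h.isFormalSum c).map v
  simp only [map_mul, ← hu, map_monomial, ← coeff_map] at h1
  exact h1

end Eval

end GSeries

/-! ### Substitution into smooth functions and series -/

namespace Cinf

variable {n : ℕ} {W : Opens (Fin n → ℝ)}

/-- Evaluation at a point. -/
def evalAt (w : W) : Cinf W →ₐ[ℝ] ℝ where
  toFun f := f.1 w
  map_one' := rfl
  map_mul' _ _ := rfl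
  map_zero' := rfl
  map_add' _ _ := rfl
  commutes' _ := rfl

theorem evalAt_apply (w : W) (f : Cinf W) : evalAt w f = f.1 w := rfl

theorem ext_evalAt {f g : Cinf W} (h : ∀ w, evalAt w f = evalAt w g) : f = g :=
  Subtype.ext (funext h)

theorem res_coord {W' : Opens (Fin n → ℝ)} (h : W' ≤ W) (μ : Fin n) :
    res h (coord W μ) = coord W' μ := rfl

end Cinf

namespace GSeries

variable {I : Type*} [NonUnitalCommSemiring I] {p : I →+ ZMod 2} {N : ℕ} {deg : Fin N → I}
  {n m M : ℕ} {W : Opens (Fin n → ℝ)} {V : Opens (Fin m → ℝ)} {deg' : Fin M → I}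

variable (p deg) in
/-- Restriction of the coefficients to a smaller open set. -/
def restrict {W' : Opens (Fin n → ℝ)} (h : W' ≤ W) :
    GSeries p deg (Cinf W) →ₐ[ℝ] GSeries p deg (Cinf W') := map (Cinf.res h)

/-! ### Taylor expansion as an algebra homomorphism. -/

section Taylor

/-- The Taylor series of a smooth function, as a series in variables of degree zero. -/
def taylor (p : I →+ ZMod 2) (f : Cinf V) : GSeries p (0 : Fin m → I) (Cinf V) :=
  fun α => MvPowerSeries.coeff α.1 (Cinf.taylorSeries f)

theorem coeff_taylor (α : Fin m →₀ ℕ) (f : Cinf V) :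
    coeff α (taylor p f) = MvPowerSeries.coeff α (Cinf.taylorSeries f) :=
  coeff_of_adm (adm_degree_zero α) _

variable (p V) in
/-- The Taylor series as an algebra homomorphism. -/
def taylorHom : Cinf V →ₐ[ℝ] GSeries p (0 : Fin m → I) (Cinf V) :=
  AlgHom.ofLinearMap
    { toFun := taylor p
      map_add' := fun f g => ext_coeff fun α _ => by
        simp only [coeff_add, coeff_taylor, Cinf.taylorSeries_add, map_add]
      map_smul' := fun r f => ext_coeff fun α _ => by
        simp only [coeff_smul, coeff_taylor, Cinf.taylorSeries_smul, RingHom.id_apply]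
        rfl }
    (ext_coeff fun α _ => by
      change coeff α (taylor p 1) = coeff α (const 1)
      rw [coeff_taylor, coeff_const]
      split_ifs with h
      · rw [h, Cinf.coeff_zero_taylorSeries]
      · exact Cinf.coeff_taylorSeries_one h)
    fun f g => ext_coeff fun α hα => by
      change coeff α (taylor p (f * g)) = coeff α (taylor p f * taylor p g)
      rw [coeff_taylor, Cinf.taylorSeries_mul, MvPowerSeries.coeff_mul, coeff_mul hα]
      refine Finset.sum_congr rfl fun q _ => ?_
      rw [coeff_taylor, coeff_taylor, swaps_degree_zero, pow_zero, one_mul]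

theorem taylorHom_apply (f : Cinf V) : taylorHom p V f = taylor p f := rfl

theorem body_taylorHom (f : Cinf V) : body (taylorHom p V f) = f :=
  (coeff_taylor 0 f).trans (Cinf.coeff_zero_taylorSeries f)

theorem taylorHom_mem_homog (f : Cinf V) : taylorHom p V f ∈ homog p (0 : Fin m → I) (Cinf V) 0 :=
  fun _ _ => by simp

theorem taylorHom_coord (μ : Fin m) :
    taylorHom p V (Cinf.coord V μ) = const (Cinf.coord V μ) + var μ :=
  ext_coeff fun α hα => by
    rw [taylorHom_apply, coeff_taylor, coeff_add, coeff_const, var, coeff_single hα]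
    by_cases h : α = 0
    · subst h
      rw [Cinf.coeff_zero_taylorSeries, if_pos rfl, if_neg, add_zero]
      exact fun e => by simpa using DFunLike.congr_fun e μ
    · rw [Cinf.coeff_taylorSeries_coord h, if_neg h, zero_add]

theorem taylorHom_res {V' : Opens (Fin m → ℝ)} (h : V' ≤ V) (f : Cinf V) :
    taylorHom p V' (Cinf.res h f) = restrict p 0 h (taylorHom p V f) :=
  ext_coeff fun α _ => by
    rw [restrict, coeff_map, taylorHom_apply, taylorHom_apply, coeff_taylor, coeff_taylor,
      Cinf.coeff_taylorSeries, Cinf.coeff_taylorSeries, Cinf.pdMulti_res, map_smul]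

end Taylor

/-- Data that may be substituted for the coordinates of a graded domain with underlying open
set `V`. -/
structure IsSubstData (V : Opens (Fin m → ℝ)) (deg' : Fin M → I)
    (y : Fin m → GSeries p deg (Cinf W)) (η : Fin M → GSeries p deg (Cinf W)) : Prop where
  even : ∀ μ, y μ ∈ homog p deg (Cinf W) 0
  var_mem : ∀ a, η a ∈ homog p deg (Cinf W) (deg' a)
  var_filt : ∀ a, η a ∈ filt p deg (Cinf W) 1
  range : ∀ w : W, (fun μ => (body (y μ)).1 w) ∈ V

namespace IsSubstData

variable {y : Fin m → GSeries p deg (Cinf W)} {η : Fin M → GSeries p deg (Cinf W)}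
  (h : IsSubstData V deg' y η)

include h in
theorem isEvalData_taylor : IsEvalData (0 : Fin m → I)
    ((constHom p deg (Cinf W)).comp (Cinf.compHom (fun μ => body (y μ)) h.range))
    (fun μ => y μ - const (body (y μ))) where
  coeff_mem _ := const_mem_homog _
  var_mem μ := Submodule.sub_mem _ (h.even μ) (const_mem_homog _)
  var_filt _ := sub_const_body_mem _

/-- Grassmann analytic continuation as an algebra homomorphism. -/
def contHom : Cinf V →ₐ[ℝ] GSeries p deg (Cinf W) :=
  h.isEvalData_taylor.evalHom.comp (taylorHom p V)

theorem contHom_apply (g : Cinf V) :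
    h.contHom g = h.isEvalData_taylor.evalHom (taylorHom p V g) := rfl

theorem contHom_coord (μ : Fin m) : h.contHom (Cinf.coord V μ) = y μ := by
  rw [contHom_apply, taylorHom_coord, map_add, IsEvalData.evalHom_apply, IsEvalData.evalHom_apply,
    h.isEvalData_taylor.evalFun_const, h.isEvalData_taylor.evalFun_var]
  exact add_sub_cancel _ _

theorem body_contHom (g : Cinf V) :
    body (h.contHom g) = Cinf.compHom (fun μ => body (y μ)) h.range g := by
  rw [contHom_apply, IsEvalData.body_evalHom, body_taylorHom]
  exact body_const _

include h in
theorem isEvalData : IsEvalData deg' h.contHom η where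
  coeff_mem g := h.isEvalData_taylor.evalHom_mem_homog (taylorHom_mem_homog g)
  var_mem := h.var_mem
  var_filt := h.var_filt

/-- The substitution `∑ c_β θ^β ↦ ∑ c_β(y) η^β`. -/
def substHom : GSeries p deg' (Cinf V) →ₐ[ℝ] GSeries p deg (Cinf W) := h.isEvalData.evalHom

theorem substHom_const (g : Cinf V) : h.substHom (const g) = h.contHom g :=
  h.isEvalData.evalFun_const g

theorem substHom_coord (μ : Fin m) : h.substHom (const (Cinf.coord V μ)) = y μ := by
  rw [substHom_const, contHom_coord]

theorem substHom_var (a : Fin M) : h.substHom (var a) = η a := h.isEvalData.evalFun_var a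

theorem substHom_filt {k : ℕ} {c : GSeries p deg' (Cinf V)} (hc : c ∈ filt p deg' (Cinf V) k) :
    h.substHom c ∈ filt p deg (Cinf W) k := h.isEvalData.evalFun_filt hc

theorem substHom_mem_homog {i : I} {c : GSeries p deg' (Cinf V)}
    (hc : c ∈ homog p deg' (Cinf V) i) : h.substHom c ∈ homog p deg (Cinf W) i :=
  h.isEvalData.evalHom_mem_homog hc

theorem body_substHom (c : GSeries p deg' (Cinf V)) (w : W) :
    (body (h.substHom c)).1 w = (body c).1 ⟨fun μ => (body (y μ)).1 w, h.range w⟩ := by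
  rw [substHom, IsEvalData.body_evalHom, body_contHom]
  rfl

theorem contHom_res {W' : Opens (Fin n → ℝ)} {V' : Opens (Fin m → ℝ)} (hV : V' ≤ V)
    (hW : W' ≤ W) (h' : IsSubstData V' deg' (fun μ => restrict p deg hW (y μ))
      fun a => restrict p deg hW (η a)) (g : Cinf V) :
    h'.contHom (Cinf.res hV g) = restrict p deg hW (h.contHom g) := by
  rw [contHom_apply, contHom_apply, taylorHom_res]
  refine h.isEvalData_taylor.map_evalHom h'.isEvalData_taylor _ _ (fun g => ?_) (fun μ => ?_) _
  · change const _ = map _ (const _)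
    rw [map_const]
    congr 1
    refine Subtype.ext (funext fun w => ?_)
    refine congrArg g.1 (Subtype.ext (funext fun μ => ?_))
    change (body (restrict p deg hW (y μ))).1 w = (body (y μ)).1 ⟨w.1, hW w.2⟩
    rw [restrict, body_map]
    rfl
  · rw [restrict, map_sub, map_const, body_map]

theorem substHom_res {W' : Opens (Fin n → ℝ)} {V' : Opens (Fin m → ℝ)} (hV : V' ≤ V)
    (hW : W' ≤ W) (h' : IsSubstData V' deg' (fun μ => restrict p deg hW (y μ))
      fun a => restrict p deg hW (η a)) (c : GSeries p deg' (Cinf V)) :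
    h'.substHom (restrict p deg' hV c) = restrict p deg hW (h.substHom c) :=
  h.isEvalData.map_evalHom h'.isEvalData _ _ (h.contHom_res hV hW h') (fun _ => rfl) c

end IsSubstData

/-- A homomorphism is determined by the images of the coordinates. -/
theorem algHom_ext_of_coord {Ψ₁ Ψ₂ : GSeries p deg' (Cinf V) →ₐ[ℝ] GSeries p deg (Cinf W)}
    (hc : ∀ μ, Ψ₁ (const (Cinf.coord V μ)) = Ψ₂ (const (Cinf.coord V μ)))
    (hv : ∀ a, Ψ₁ (var a) = Ψ₂ (var a))
    (hV : ∀ w, (fun μ => (body (Ψ₁ (const (Cinf.coord V μ)))).1 w) ∈ V)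
    (h0 : ∀ a, Ψ₁ (var a) ∈ filt p deg (Cinf W) 1) : Ψ₁ = Ψ₂ := by
  -- After evaluation of the coefficients at a fixed point `w`, the difference of the two
  -- homomorphisms is shown to have order at least K, by induction on K and for all `f` at once.
  have key : ∀ (w : W) (K : ℕ) (f : GSeries p deg' (Cinf V)),
      map (Cinf.evalAt w) (Ψ₁ f - Ψ₂ f) ∈ filt p deg ℝ K := by
    intro w K
    induction K with
    | zero => exact fun f => filt_zero _
    | succ K ih =>
      intro f
      -- The base point b is the value at `w` of the bodies of the images of the coordinates, so
      -- that Ψ₁(t^μ) - b_μ has zero body at `w`.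
      obtain ⟨g, hg⟩ := Cinf.hadamard (body f) ⟨_, hV w⟩
      obtain ⟨k, -, hk⟩ := exists_eq_sum_mul_var (k := 0) (sub_const_body_mem f)
      set r : ℝ := (body f).1 ⟨_, hV w⟩
      set b : Fin m → ℝ := fun μ => (body (Ψ₁ (const (Cinf.coord V μ)))).1 w
      have hf : f = algebraMap ℝ _ r + ∑ μ, (const (Cinf.coord V μ) - algebraMap ℝ _ (b μ)) *
          const (g μ) + ∑ a, k a * var a := by
        have hb := congrArg (constHom p deg' (Cinf V)) hg
        simp only [map_add, map_sum, map_mul, map_sub, AlgHom.commutes] at hb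
        refine (sub_eq_iff_eq_add'.1 hk).trans ?_
        exact congrArg (· + ∑ a, k a * var a) hb
      -- The constants cancel. Each remaining term is a difference covered by the induction
      -- hypothesis times a factor which at `w` has order at least 1.
      have hΨ : Ψ₁ f - Ψ₂ f =
          ∑ μ, (Ψ₁ (const (Cinf.coord V μ)) - algebraMap ℝ _ (b μ)) *
            (Ψ₁ (const (g μ)) - Ψ₂ (const (g μ))) + ∑ a, (Ψ₁ (k a) - Ψ₂ (k a)) * Ψ₁ (var a) := by
        rw [hf]
        simp only [map_add, map_sum, map_mul, map_sub, AlgHom.commutes, mul_sub, sub_mul, hc, hv,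
          Finset.sum_sub_distrib]
        abel
      rw [hΨ, map_add, map_sum, map_sum]
      refine Submodule.add_mem _ (Submodule.sum_mem _ fun μ _ => ?_)
        (Submodule.sum_mem _ fun a _ => ?_)
      · rw [map_mul, add_comm]
        refine filt_mul ?_ (ih _)
        rw [filt_one, body_map, body_sub, map_sub, ← bodyHom_apply (algebraMap ℝ _ (b μ)),
          AlgHom.commutes, AlgHom.commutes]
        exact sub_self _
      · rw [map_mul]
        exact filt_mul (ih _) (map_mem_filt _ (h0 a))
  refine AlgHom.ext fun f => ext_coeff fun γ _ => Cinf.ext_evalAt fun w => ?_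
  have h := key w (wt γ + 1) f γ (Nat.lt_succ_self _)
  rw [coeff_map, coeff_sub, map_sub, sub_eq_zero] at h
  exact h

end GSeries

namespace GDomain

open GSeries

variable {I : Type*} [NonUnitalCommSemiring I] {p : I →+ ZMod 2} {D : GDomain I}
  {W : Opens (Fin D.n → ℝ)} {m M : ℕ} {V : Opens (Fin m → ℝ)} {deg' : Fin M → I}
  {y : Fin m → D.Sec p W} {η : Fin M → D.Sec p W}

theorem continuation_eq_contHom (h : IsSubstData V deg' y η) (g : Cinf V)
    (hy : ∀ w : W, bodyMap y w ∈ V) : continuation g y hy = h.contHom g := by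
  let e : {α : Fin m →₀ ℕ // Adm p (0 : Fin m → I) α} ≃ (Fin m → ℕ) :=
    (Equiv.subtypeUnivEquiv adm_degree_zero).trans Finsupp.equivFunOnFinite
  refine ext_coeff fun γ hγ => ?_
  rw [h.contHom_apply, IsEvalData.evalHom_apply,
    (h.isEvalData_taylor.isFormalSum (taylorHom p V g) γ).2, coeff_of_adm hγ]
  refine ((finsum_comp_equiv e).symm).trans (finsum_congr fun α => ?_)
  have hα : coeff α.1 (taylorHom p V g) =
      (∏ μ, ((α.1 μ).factorial : ℝ))⁻¹ • Cinf.pdMulti α.1 g := by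
    rw [taylorHom_apply, coeff_taylor, Cinf.coeff_taylorSeries]
  exact congrArg (fun r => coeff γ (((constHom p D.deg (Cinf W)).comp
    (Cinf.compHom (fun μ => body (y μ)) h.range)) r *
      GSeries.monomial (fun μ => y μ - const (body (y μ))) α.1)) hα.symm

/-- A formal sum has at most one value, so being an expansion is the graph of the substitution
homomorphism. Existence and uniqueness of expansions thereby become its bijectivity. -/
theorem isExpansion_iff (h : IsSubstData V deg' y η) (hy : ∀ w : W, bodyMap y w ∈ V)
    (c : GSeries p deg' (Cinf V)) (f : D.Sec p W) :
    IsExpansion c y hy η f ↔ h.substHom c = f := by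
  have hs : IsExpansion c y hy η f ↔ IsFormalSum
      (fun β : {β : Fin M →₀ ℕ // Adm p deg' β} =>
        h.contHom (coeff β.1 c) * GSeries.monomial η β.1) f := by
    unfold IsExpansion
    simp only [continuation_eq_contHom h, fun β : {β : Fin M →₀ ℕ // Adm p deg' β} =>
      coeff_of_adm β.2 c]
  rw [hs]
  exact ⟨fun hf => (h.isEvalData.isFormalSum c).unique hf,
    fun hf => hf ▸ h.isEvalData.isFormalSum c⟩

end GDomain

/-! ### Expansions in a coordinate system -/

namespace GDomain

open GSeries

variable {I : Type*} [NonUnitalCommSemiring I] {p : I →+ ZMod 2} {D : GDomain I}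
  {x : Fin D.n → D.Sec p D.U} {θ : Fin D.N → D.Sec p D.U}

namespace IsCoordinateSystem

variable (h : D.IsCoordinateSystem p x θ)

include h in
theorem isSubstData : IsSubstData h.image D.deg x θ where
  even := h.x_mem
  var_mem := h.θ_mem
  var_filt a := filt_one.2 (body_eq_zero_of_mem_homog (D.deg_ne_zero a) (h.θ_mem a))
  range u := Set.mem_range_self u

include h in
theorem exists_comp_eq (r : Cinf D.U) :
    ∃ s : Cinf h.image, Cinf.compHom (fun μ => body (x μ)) h.isSubstData.range s = r := by
  obtain ⟨g, hg, hgx⟩ := h.smooth_inverse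
  refine ⟨⟨fun v => zeroExt r.1 (g v), fun v => zeroExt r.1 (g v),
    (contDiffOn_zeroExt r).comp hg ?_, fun _ => rfl⟩, Subtype.ext (funext fun u => ?_)⟩
  · rintro _ ⟨u, rfl⟩
    rw [hgx]
    exact u.2
  · change zeroExt r.1 (g (bodyMap x u)) = r.1 u
    rw [hgx, zeroExt_apply]

theorem comp_injective {s : Cinf h.image}
    (hs : Cinf.compHom (fun μ => body (x μ)) h.isSubstData.range s = 0) : s = 0 := by
  refine Subtype.ext (funext ?_)
  rintro ⟨_, u, rfl⟩
  exact congrFun (congrArg Subtype.val hs) u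

/-- Elements of this form are closed under products: in P · (d + ∑ l_a θ_a) the function d is
central, so P d is again of this form and P l_a is absorbed into the coefficients. -/
theorem exists_eq_const_add {P : D.Sec p D.U} (hP : P ∈ Algebra.adjoin ℝ
    (Set.range (GSeries.const : Cinf D.U → D.Sec p D.U) ∪ Set.range θ)) :
    ∃ (c : Cinf D.U) (k : Fin D.N → D.Sec p D.U), P = const c + ∑ a, k a * θ a := by
  classical
  induction hP using Algebra.adjoin_induction with
  | mem P hP =>
    rcases hP with ⟨c, rfl⟩ | ⟨a, rfl⟩
    · exact ⟨c, 0, by simp⟩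
    · refine ⟨0, Pi.single a 1, ?_⟩
      rw [← constHom_apply, map_zero, zero_add, Finset.sum_eq_single a]
      · simp
      · intro b _ hb
        simp [hb]
      · simp
  | algebraMap r =>
    refine ⟨algebraMap ℝ _ r, 0, ?_⟩
    rw [← constHom_apply, AlgHom.commutes]
    simp
  | add P Q _ _ hP hQ =>
    obtain ⟨c, k, rfl⟩ := hP
    obtain ⟨d, l, rfl⟩ := hQ
    refine ⟨c + d, k + l, ?_⟩
    simp only [← constHom_apply, map_add, Pi.add_apply, add_mul, Finset.sum_add_distrib]
    abel
  | mul P Q _ _ hP hQ =>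
    obtain ⟨c, k, hP⟩ := hP
    obtain ⟨d, l, rfl⟩ := hQ
    refine ⟨c * d, fun a => k a * const d + P * l a, ?_⟩
    have h1 : ∀ a, k a * const d * θ a = k a * θ a * const d := fun a => by
      rw [mul_assoc, mul_comm_of_mem_homog_zero (const_mem_homog d), mul_assoc]
    simp only [add_mul, Finset.sum_add_distrib, h1]
    rw [mul_add, Finset.mul_sum, ← Finset.sum_mul, ← add_assoc, const_mul, ← add_mul, ← hP]
    simp only [mul_assoc]

include h in
-- Density is used only modulo order 2: the θ_a generate the terms of order 1. The function in
-- `exists_eq_const_add` is zero, as the body of everything else vanishes.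
theorem exists_var_sub_mem (b : Fin D.N) : ∃ k : Fin D.N → D.Sec p D.U,
    var b - ∑ a, k a * θ a ∈ filt p D.deg (Cinf D.U) 2 := by
  obtain ⟨P, hP, hb⟩ := h.generate (var b) 2
  obtain ⟨c, k, rfl⟩ := exists_eq_const_add hP
  have hm : var b - (const c + ∑ a, k a * θ a) ∈ filt p D.deg (Cinf D.U) 2 := hb
  have hk : ∑ a, k a * θ a ∈ filt p D.deg (Cinf D.U) 1 :=
    Submodule.sum_mem _ fun a _ => filt_mul_left _ (h.isSubstData.var_filt a)
  have hc : c = 0 := by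
    have h1 := filt_one.1 (filt_anti one_le_two hm)
    rw [← bodyHom_apply, map_sub, map_add, bodyHom_apply, bodyHom_apply, bodyHom_apply,
      filt_one.1 hk, filt_one.1 (var_mem_filt b), body_const] at h1
    simpa using h1
  refine ⟨k, ?_⟩
  rwa [hc, ← constHom_apply, map_zero, zero_add] at hm

/-- Write f = ∑ l_b var_b with l_b of order k, and replace var_b by ∑_a C_ba θ_a at the cost of an
error of order k + 2. The induction hypothesis then applies to the coefficient ∑_b l_b C_ba of each
θ_a. -/
theorem exists_substHom_sub_mem (k : ℕ) : ∀ f ∈ filt p D.deg (Cinf D.U) k,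
    ∃ c ∈ filt p D.deg (Cinf h.image) k,
      f - h.isSubstData.substHom c ∈ filt p D.deg (Cinf D.U) (k + 1) := by
  induction k with
  | zero =>
    intro f _
    obtain ⟨s, hs⟩ := h.exists_comp_eq (body f)
    refine ⟨const s, filt_zero _, ?_⟩
    rw [filt_one, body_sub, IsSubstData.substHom_const, IsSubstData.body_contHom, hs, sub_self]
  | succ k ih =>
    intro f hf
    obtain ⟨l, hl, rfl⟩ := exists_eq_sum_mul_var hf
    choose C hC using h.exists_var_sub_mem
    have hg : ∀ a, ∑ b, l b * C b a ∈ filt p D.deg (Cinf D.U) k := fun a =>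
      Submodule.sum_mem _ fun b _ => filt_mul_right (hl b) _
    choose c hc hc' using fun a => ih _ (hg a)
    refine ⟨∑ a, c a * var a, Submodule.sum_mem _ fun a _ => filt_mul (hc a) (var_mem_filt a), ?_⟩
    have e : ∑ b, l b * var b - h.isSubstData.substHom (∑ a, c a * var a) =
        ∑ b, l b * (var b - ∑ a, C b a * θ a) +
          ∑ a, (∑ b, l b * C b a - h.isSubstData.substHom (c a)) * θ a := by
      simp only [map_sum, map_mul, IsSubstData.substHom_var, mul_sub, sub_mul,
        Finset.sum_sub_distrib, Finset.mul_sum, Finset.sum_mul, mul_assoc]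
      rw [Finset.sum_comm (f := fun a b => l b * (C b a * θ a))]
      abel
    rw [e]
    refine Submodule.add_mem _ (Submodule.sum_mem _ fun b _ => ?_)
      (Submodule.sum_mem _ fun a _ => filt_mul (hc' a) (h.isSubstData.var_filt a))
    have := filt_mul (hl b) (hC b)
    rwa [add_assoc]

theorem substHom_surjective : Function.Surjective h.isSubstData.substHom :=
  surjective_of_filt h.isSubstData.substHom.toRingHom.toAddMonoidHom
     (fun _ _ hc => h.isSubstData.substHom_filt hc)
    h.exists_substHom_sub_mem

/-! ### Leading coefficients and uniqueness of the expansion. -/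

variable (p D) in
/-- The exponents of the monomials of order `k`. -/
abbrev Exponents (k : ℕ) : Type := {β : Fin D.N →₀ ℕ // Adm p D.deg β ∧ wt β = k}

instance (k : ℕ) : Finite (Exponents p D k) :=
  ((finite_wt_lt D.N (k + 1)).subset fun _ hβ => Nat.lt_succ_of_le hβ.2.le : Set.Finite
    {β : Fin D.N →₀ ℕ | Adm p D.deg β ∧ wt β = k}).to_subtype

instance (k : ℕ) : Fintype (Exponents p D k) := Fintype.ofFinite _

theorem coeff_sum_single {R : Type*} [CommRing R] [Algebra ℝ R] {k : ℕ} (d : Exponents p D k → R)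
    (γ : Exponents p D k) :
    coeff γ.1 (∑ β, single β.1 (d β) : GSeries p D.deg R) = d γ := by
  rw [coeff_sum, Finset.sum_eq_single γ, coeff_single_self γ.2.1]
  · exact fun β _ hβ => coeff_single_of_ne (fun e => hβ (Subtype.ext e.symm)) _
  · simp

theorem sum_single_mem {R : Type*} [CommRing R] [Algebra ℝ R] {k : ℕ} (d : Exponents p D k → R) :
    (∑ β, single β.1 (d β) : GSeries p D.deg R) ∈ filt p D.deg R k :=
  Submodule.sum_mem _ fun β _ => by
    have := single_mem_filt (p := p) (deg := D.deg) β.1 (d β)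
    rwa [β.2.2] at this

theorem sub_sum_single_mem_succ {R : Type*} [CommRing R] [Algebra ℝ R] {k : ℕ}
    {c : GSeries p D.deg R} (hc : c ∈ filt p D.deg R k) :
    c - ∑ β : Exponents p D k, single β.1 (coeff β.1 c) ∈ filt p D.deg R (k + 1) := by
  intro γ hγ
  rw [coeff_sub]
  rcases Nat.lt_succ_iff_lt_or_eq.1 hγ with hlt | heq
  · rw [hc γ hlt, sum_single_mem _ γ hlt, sub_zero]
  · by_cases had : Adm p D.deg γ
    · rw [coeff_sum_single (fun β : Exponents p D k => coeff β.1 c) ⟨γ, had, heq⟩, sub_self]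
    · rw [coeff_of_not_adm had, coeff_of_not_adm had, sub_zero]

variable (p θ) in
/-- The matrix of the leading coefficients of the monomials of order `k`. -/
def leadingMatrix (k : ℕ) : Matrix (Exponents p D k) (Exponents p D k) (Cinf D.U) :=
  fun γ β => coeff γ.1 (GSeries.monomial θ β.1)

/-- Monomials θ^β of order k are multiplied, as far as order k is concerned, only by the body of the
continued coefficient. So substitution is linear over C^∞(U) on leading coefficients. -/
theorem coeff_substHom {k : ℕ} {c : GSeries p D.deg (Cinf h.image)}
    (hc : c ∈ filt p D.deg (Cinf h.image) k) (γ : Exponents p D k) :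
    coeff γ.1 (h.isSubstData.substHom c) =
      (leadingMatrix p θ k).mulVec (fun β =>
        Cinf.compHom (fun μ => body (x μ)) h.isSubstData.range (coeff β.1 c)) γ := by
  have h1 := h.isSubstData.substHom_filt (sub_sum_single_mem_succ hc) γ.1 (by rw [γ.2.2]; omega)
  rw [map_sub, coeff_sub, sub_eq_zero, map_sum, coeff_sum] at h1
  rw [h1]
  refine Finset.sum_congr rfl fun β _ => ?_
  have h2 : h.isSubstData.substHom (single β.1 (coeff β.1 c)) =
      h.isSubstData.contHom (coeff β.1 c) * GSeries.monomial θ β.1 :=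
    h.isSubstData.isEvalData.evalFun_single _ _
  have h3 := monomial_mem_filt h.isSubstData.var_filt β.1
  rw [h2, coeff_mul_of_mem_filt, IsSubstData.body_contHom, mul_comm]
  · rfl
  · rw [show ∑ a, β.1 a = k from β.2.2] at h3
    rwa [γ.2.2]

/-- Solvability in order k makes the leading matrix surjective. It is a square matrix over a
commutative ring, and a surjective endomorphism of a finite module is injective. -/
theorem mem_filt_succ_of_substHom_eq_zero {k : ℕ} {c : GSeries p D.deg (Cinf h.image)}
    (hc : c ∈ filt p D.deg (Cinf h.image) k) (h0 : h.isSubstData.substHom c = 0) :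
    c ∈ filt p D.deg (Cinf h.image) (k + 1) := by
  have hsurj : Function.Surjective (leadingMatrix p θ k).mulVecLin := by
    intro d
    obtain ⟨e, he, he'⟩ := h.exists_substHom_sub_mem k _ (sum_single_mem d)
    refine ⟨_, funext fun γ => (h.coeff_substHom he γ).symm.trans ?_⟩
    have h1 := he' γ.1 (by rw [γ.2.2]; omega)
    rw [coeff_sub, coeff_sum_single, sub_eq_zero] at h1
    exact h1.symm
  have hinj := OrzechProperty.injective_of_surjective_endomorphism _ hsurj
  have hz : (fun β : Exponents p D k =>
      Cinf.compHom (fun μ => body (x μ)) h.isSubstData.range (coeff β.1 c)) = 0 := by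
    refine hinj (funext fun γ => ?_)
    rw [map_zero]
    refine (h.coeff_substHom hc γ).symm.trans ?_
    rw [h0, coeff_zero]
    rfl
  intro γ hγ
  rcases Nat.lt_succ_iff_lt_or_eq.1 hγ with hlt | heq
  · exact hc γ hlt
  · by_cases had : Adm p D.deg γ
    · exact h.comp_injective (congrFun hz ⟨γ, had, heq⟩)
    · exact coeff_of_not_adm had _

theorem substHom_injective : Function.Injective h.isSubstData.substHom := by
  rw [injective_iff_map_eq_zero]
  intro c h0
  refine eq_zero_of_forall_filt fun k => ?_
  induction k with
  | zero => exact filt_zero _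
  | succ k ih => exact h.mem_filt_succ_of_substHom_eq_zero ih h0

/-- The expansion of sections in the coordinates. -/
def expansionEquiv : GSeries p D.deg (Cinf h.image) ≃ₐ[ℝ] D.Sec p D.U :=
  AlgEquiv.ofBijective h.isSubstData.substHom ⟨h.substHom_injective, h.substHom_surjective⟩

/-- Split the expansion c into its part c₁ of degree i and the rest. The image of the rest has no
terms of degree i, yet it is a difference of two elements of degree i. So it vanishes, and the rest
is zero by injectivity. -/
theorem expansionEquiv_symm_mem_homog {i : I} {f : D.Sec p D.U}
    (hf : f ∈ homog p D.deg (Cinf D.U) i) :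
    h.expansionEquiv.symm f ∈ homog p D.deg (Cinf h.image) i := by
  classical
  obtain ⟨c, rfl⟩ := h.expansionEquiv.surjective f
  rw [AlgEquiv.symm_apply_apply]
  let c₁ : GSeries p D.deg (Cinf h.image) :=
    fun β => if degOf D.deg β.1 = i then coeff β.1 c else 0
  have hc₁ : ∀ β, coeff β c₁ = if degOf D.deg β = i then coeff β c else 0 := by
    intro β
    by_cases had : Adm p D.deg β
    · rw [coeff_of_adm had]
    · simp [coeff_of_not_adm had]
  have h₁ : c₁ ∈ homog p D.deg (Cinf h.image) i := by
    intro β hβ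
    rw [hc₁] at hβ
    by_contra hne
    exact hβ (if_neg hne)
  have h₂ : ∀ β, coeff β (c - c₁) ≠ 0 → degOf D.deg β ≠ i := by
    intro β hβ e
    rw [coeff_sub, hc₁, if_pos e, sub_self] at hβ
    exact hβ rfl
  have h₃ : h.expansionEquiv (c - c₁) = 0 := by
    refine ext_coeff fun γ _ => ?_
    rw [coeff_zero]
    by_contra hne
    have hm : h.expansionEquiv (c - c₁) ∈ homog p D.deg (Cinf D.U) i := by
      rw [map_sub]
      exact Submodule.sub_mem _ hf (h.isSubstData.substHom_mem_homog h₁)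
    exact h.isSubstData.isEvalData.degree_of_coeff_ne_zero (Q := fun j => j ≠ i) h₂ hne
      (hm γ hne)
  rw [← sub_eq_zero.1 ((map_eq_zero_iff _ h.expansionEquiv.injective).1 h₃)] at h₁
  exact h₁

end IsCoordinateSystem

end GDomain

/-! ### Morphisms of graded domains -/

namespace GDomain

open GSeries

variable {I : Type*} [NonUnitalCommSemiring I] {p : I →+ ZMod 2} {D D₁ D₂ : GDomain I}

theorem body_res {W' W : Opens (Fin D.n → ℝ)} (h : W' ≤ W) (f : D.Sec p W) (w : W') :
    (body (D.res p h f)).1 w = (body f).1 ⟨w.1, h w.2⟩ := by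
  rw [res, body_map]
  rfl

/-- If the body is non-zero at `w`, it is non-zero on a neighbourhood by continuity, and a section
with invertible body is invertible. Locality of a morphism thus becomes a statement about bodies. -/
theorem isUnitAt_iff {W : Opens (Fin D.n → ℝ)} (f : D.Sec p W) (w : W) :
    D.IsUnitAt p f w ↔ (body f).1 w ≠ 0 := by
  constructor
  · rintro ⟨W', h, hw, hu⟩
    have h1 := (hu.map (bodyHom p D.deg (Cinf W'))).map (Cinf.evalAt ⟨w.1, hw⟩)
    rw [bodyHom_apply, Cinf.evalAt_apply, body_res] at h1
    exact h1.ne_zero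
  · intro h0
    let W' : Opens (Fin D.n → ℝ) := ⟨Subtype.val '' {v : W | (body f).1 v ≠ 0},
      W.isOpen.isOpenMap_subtype_val _
        (isOpen_compl_singleton.preimage (Cinf.continuous_coe (body f)))⟩
    have hW : W' ≤ W := by
      rintro _ ⟨v, _, rfl⟩
      exact v.2
    refine ⟨W', hW, ⟨w, h0, rfl⟩, isUnit_of_body (Cinf.isUnit_of_ne_zero _ ?_)⟩
    rintro ⟨_, v, hv, rfl⟩
    rw [body_res]
    exact hv

theorem preim_le (b : C(D₁.U, D₂.U)) (W : Opens (Fin D₂.n → ℝ)) : preim b W ≤ D₁.U :=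
  fun _ hx => hx.1

/-- Morphisms are compatible with the body maps. -/
theorem Hom.body_pull (φ : Hom p D₁ D₂) {W : Opens (Fin D₂.n → ℝ)} (hW : W ≤ D₂.U)
    (f : D₂.Sec p W) (u : D₁.U) (hu : (φ.base u : Fin D₂.n → ℝ) ∈ W) :
    (body (φ.pull W hW f)).1 ⟨u.1, u.2, hu⟩ = (body f).1 ⟨φ.base u, hu⟩ := by
  by_contra hne
  set c := (body f).1 ⟨φ.base u, hu⟩
  -- If the values differed, the pullback of f - c would be a unit at `u`. By locality f - c would
  -- be a unit at the image point, where its body vanishes.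
  have h1 : D₁.IsUnitAt p (φ.pull W hW (f - algebraMap ℝ _ c)) u := by
    refine (isUnitAt_iff (W := preim φ.base W) _ ⟨u.1, u.2, hu⟩).2 ?_
    rw [← bodyHom_apply, map_sub, map_sub, AlgHom.commutes, AlgHom.commutes]
    exact sub_ne_zero.2 hne
  have h2 := φ.pull_local W hW _ u hu h1
  refine (isUnitAt_iff (W := W) _ ⟨φ.base u, hu⟩).1 h2 ?_
  rw [← bodyHom_apply, map_sub, AlgHom.commutes]
  exact sub_self _

theorem Hom.pullGlobal_apply (φ : Hom p D₁ D₂) (f : D₂.Sec p D₂.U) :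
    φ.pullGlobal f = D₁.res p (le_preim φ.base) (φ.pull D₂.U le_rfl f) := rfl

theorem Hom.body_pullGlobal (φ : Hom p D₁ D₂) (f : D₂.Sec p D₂.U) (u : D₁.U) :
    (body (φ.pullGlobal f)).1 u = (body f).1 (φ.base u) := by
  rw [φ.pullGlobal_apply, body_res]
  exact φ.body_pull le_rfl f u (φ.base u).2

theorem Hom.pullGlobal_mem_homog (φ : Hom p D₁ D₂) {i : I} {f : D₂.Sec p D₂.U}
    (hf : f ∈ homog p D₂.deg (Cinf D₂.U) i) : φ.pullGlobal f ∈ homog p D₁.deg (Cinf D₁.U) i := by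
  rw [φ.pullGlobal_apply]
  exact map_mem_homog _ (φ.pull_homog _ le_rfl i f hf)

theorem Hom.pull_res_eq (φ : Hom p D₁ D₂) {W : Opens (Fin D₂.n → ℝ)} (hW : W ≤ D₂.U)
    (f : D₂.Sec p D₂.U) :
    φ.pull W hW (D₂.res p hW f) = D₁.res p (preim_le φ.base W) (φ.pullGlobal f) :=
  (φ.pull_res W D₂.U hW le_rfl f).trans rfl

theorem res_const {W' W : Opens (Fin D.n → ℝ)} (h : W' ≤ W) (r : Cinf W) :
    D.res p h (const r) = const (Cinf.res h r) := map_const _ _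

theorem res_var {W' W : Opens (Fin D.n → ℝ)} (h : W' ≤ W) (a : Fin D.N) :
    D.res p h (var a) = var a := map_var _ _

/-- A morphism is determined by the pullback of global sections. -/
theorem Hom.ext_of_pullGlobal {φ ψ : Hom p D₁ D₂}
    (h : ∀ f : D₂.Sec p D₂.U, φ.pullGlobal f = ψ.pullGlobal f) : φ = ψ := by
  have hb : φ.base = ψ.base := by
    -- The underlying map is read off from the bodies of the pulled back standard coordinates.
    refine ContinuousMap.ext fun u => Subtype.ext (funext fun μ => ?_)
    have h1 := φ.body_pullGlobal (const (Cinf.coord D₂.U μ)) u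
    have h2 := ψ.body_pullGlobal (const (Cinf.coord D₂.U μ)) u
    rw [body_const] at h1 h2
    exact h1.symm.trans ((congrArg (fun g => (body g).1 u) (h _)).trans h2)
  rcases φ with ⟨b, P, h₁, h₂, h₃⟩
  rcases ψ with ⟨b', P', h₁', h₂', h₃'⟩
  obtain rfl : b = b' := hb
  obtain rfl : P = P' := by
    let φ : Hom p D₁ D₂ := ⟨b, P, h₁, h₂, h₃⟩
    let ψ : Hom p D₁ D₂ := ⟨b, P', h₁', h₂', h₃'⟩
    have hres : ∀ W (hW : W ≤ D₂.U) (f : D₂.Sec p D₂.U),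
        P W hW (D₂.res p hW f) = P' W hW (D₂.res p hW f) := fun W hW f =>
      (φ.pull_res_eq hW f).trans ((congrArg _ (h f)).trans (ψ.pull_res_eq hW f).symm)
    funext W hW
    -- A section over `W` need not extend to `D₂.U`. The standard coordinates do extend, and they
    -- determine a homomorphism on 𝒪(W).
    refine algHom_ext_of_coord (fun μ => ?_) (fun a => ?_) (fun w => ?_) fun a => ?_
    · have := hres W hW (const (Cinf.coord D₂.U μ))
      rwa [res_const, Cinf.res_coord] at this
    · have := hres W hW (var a)
      rwa [res_var] at this
    · have e : (fun μ => (body (P W hW (const (Cinf.coord W μ)))).1 w) =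
          (b ⟨w.1, w.2.1⟩ : Fin D₂.n → ℝ) := funext fun μ => by
        refine (φ.body_pull hW (const (Cinf.coord W μ)) ⟨w.1, w.2.1⟩ w.2.2).trans ?_
        rw [body_const]
        rfl
      rw [e]
      exact w.2.2
    · exact filt_one.2 (body_eq_zero_of_mem_homog (D₂.deg_ne_zero a)
        (h₂ W hW _ _ (var_mem_homog a)))
  rfl

/-- The continuous map with components `ε(z^μ)`. -/
def _root_.IGraded.GSeries.IsSubstData.base {z : Fin D₂.n → D₁.Sec p D₁.U}
    {ζ : Fin D₂.N → D₁.Sec p D₁.U} (h : IsSubstData D₂.U D₂.deg z ζ) : C(D₁.U, D₂.U) where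
  toFun u := ⟨fun μ => (body (z μ)).1 u, h.range u⟩
  continuous_toFun := Continuous.subtype_mk
    (continuous_pi fun μ => Cinf.continuous_coe (body (z μ))) _

theorem _root_.IGraded.GSeries.IsSubstData.restrict_preim {z : Fin D₂.n → D₁.Sec p D₁.U}
    {ζ : Fin D₂.N → D₁.Sec p D₁.U} (h : IsSubstData D₂.U D₂.deg z ζ)
    (W : Opens (Fin D₂.n → ℝ)) :
    IsSubstData W D₂.deg (fun μ => restrict p D₁.deg (preim_le h.base W) (z μ))
      fun a => restrict p D₁.deg (preim_le h.base W) (ζ a) where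
  even μ := map_mem_homog _ (h.even μ)
  var_mem a := map_mem_homog _ (h.var_mem a)
  var_filt a := map_mem_filt _ (h.var_filt a)
  range w := by
    obtain ⟨hw, hb⟩ := w.2
    have e : (fun μ => (body (restrict p D₁.deg (preim_le h.base W) (z μ))).1 w) =
        (h.base ⟨w.1, hw⟩ : Fin D₂.n → ℝ) := funext fun μ => body_res _ _ _
    rw [e]
    exact hb

/-- The morphism given by substitution for the standard coordinates. -/
def _root_.IGraded.GSeries.IsSubstData.hom {z : Fin D₂.n → D₁.Sec p D₁.U}
    {ζ : Fin D₂.N → D₁.Sec p D₁.U} (h : IsSubstData D₂.U D₂.deg z ζ) : Hom p D₁ D₂ where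
  base := h.base
  pull W _ := (h.restrict_preim W).substHom
  pull_res W' W hW _ f :=
    (h.restrict_preim W).substHom_res hW (preim_mono h.base hW) (h.restrict_preim W') f
  pull_homog W _ _ _ hf := (h.restrict_preim W).substHom_mem_homog hf
  pull_local W _ f u hu hf := by
    have h1 := (isUnitAt_iff (W := preim h.base W) _ ⟨u.1, u.2, hu⟩).1 hf
    refine (isUnitAt_iff f ⟨h.base u, hu⟩).2 fun h0 => h1 ?_
    rw [IsSubstData.body_substHom, ← h0]
    refine congrArg (body f).1 (Subtype.ext (funext fun μ => ?_))
    exact body_res _ _ _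

theorem _root_.IGraded.GSeries.IsSubstData.pullGlobal_hom {z : Fin D₂.n → D₁.Sec p D₁.U}
    {ζ : Fin D₂.N → D₁.Sec p D₁.U} (h : IsSubstData D₂.U D₂.deg z ζ) (f : D₂.Sec p D₂.U) :
    h.hom.pullGlobal f = h.substHom f :=
  ((h.restrict_preim D₂.U).substHom_res le_rfl (le_preim h.base) h f).symm

end GDomain

/-! ### Morphisms in coordinates -/

namespace GDomain

open GSeries

variable {I : Type*} [NonUnitalCommSemiring I] {p : I →+ ZMod 2} {D₁ D₂ : GDomain I}
  {x : Fin D₂.n → D₂.Sec p D₂.U} {θ : Fin D₂.N → D₂.Sec p D₂.U}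

namespace IsCoordinateSystem

variable (h : D₂.IsCoordinateSystem p x θ)

theorem bodyMap_pullGlobal_mem (φ : Hom p D₁ D₂) (u : D₁.U) :
    bodyMap (fun μ => φ.pullGlobal (x μ)) u ∈ h.image :=
  ⟨φ.base u, funext fun μ => (φ.body_pullGlobal (x μ) u).symm⟩

include h in
/-- A morphism is determined by the images of the coordinates. -/
theorem hom_ext {φ ψ : Hom p D₁ D₂} (hx : ∀ μ, φ.pullGlobal (x μ) = ψ.pullGlobal (x μ))
    (hθ : ∀ a, φ.pullGlobal (θ a) = ψ.pullGlobal (θ a)) : φ = ψ := by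
  -- Composition with the expansion turns x, θ into the standard coordinates over Ω, for which the
  -- extensionality lemma is available.
  have e : φ.pullGlobal.comp h.isSubstData.substHom = ψ.pullGlobal.comp h.isSubstData.substHom := by
    refine algHom_ext_of_coord (fun μ => ?_) (fun a => ?_) (fun w => ?_) fun a => ?_
    · simpa [IsSubstData.substHom_coord] using hx μ
    · simpa [IsSubstData.substHom_var] using hθ a
    · simp only [AlgHom.comp_apply, IsSubstData.substHom_coord]
      exact h.bodyMap_pullGlobal_mem φ w
    · rw [AlgHom.comp_apply, IsSubstData.substHom_var]
      exact filt_one.2 (body_eq_zero_of_mem_homog (D₂.deg_ne_zero a)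
        (φ.pullGlobal_mem_homog (h.θ_mem a)))
  refine Hom.ext_of_pullGlobal fun f => ?_
  obtain ⟨c, rfl⟩ := h.substHom_surjective f
  exact DFunLike.congr_fun e c

variable {y : Fin D₂.n → D₁.Sec p D₁.U} {η : Fin D₂.N → D₁.Sec p D₁.U}
  (hs : IsSubstData h.image D₂.deg y η)

/-- The homomorphism `∑ c_β(x) θ^β ↦ ∑ c_β(y) η^β`. -/
def transfer : D₂.Sec p D₂.U →ₐ[ℝ] D₁.Sec p D₁.U :=
  hs.substHom.comp (h.expansionEquiv.symm : D₂.Sec p D₂.U →ₐ[ℝ] _)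

theorem transfer_substHom (c : GSeries p D₂.deg (Cinf h.image)) :
    h.transfer hs (h.isSubstData.substHom c) = hs.substHom c :=
  congrArg hs.substHom (h.expansionEquiv.symm_apply_apply c)

theorem transfer_mem_homog {i : I} {f : D₂.Sec p D₂.U} (hf : f ∈ homog p D₂.deg (Cinf D₂.U) i) :
    h.transfer hs f ∈ homog p D₁.deg (Cinf D₁.U) i :=
  hs.substHom_mem_homog (h.expansionEquiv_symm_mem_homog hf)

/-- As Ω is the range of ε(x), the point ε(y)(u) equals ε(x)(v) for some `v`; this is where the
morphism under construction sends `u`. -/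
theorem exists_body_transfer (u : D₁.U) :
    ∃ v : D₂.U, ∀ f, (body (h.transfer hs f)).1 u = (body f).1 v := by
  obtain ⟨v, hv⟩ := hs.range u
  refine ⟨v, fun f => ?_⟩
  obtain ⟨c, rfl⟩ := h.substHom_surjective f
  rw [transfer_substHom, IsSubstData.body_substHom, IsSubstData.body_substHom]
  exact congrArg (body c).1 (Subtype.ext hv.symm)

/-- The expansion in x, θ is established for global sections only. The images of the standard
coordinates, in contrast, can be restricted and substituted over each open subset of U₂. -/
theorem isSubstData_transfer : IsSubstData D₂.U D₂.deg
    (fun μ => h.transfer hs (const (Cinf.coord D₂.U μ))) fun a => h.transfer hs (var a) where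
  even _ := h.transfer_mem_homog hs (const_mem_homog _)
  var_mem a := h.transfer_mem_homog hs (var_mem_homog a)
  var_filt a := filt_one.2 (body_eq_zero_of_mem_homog (D₂.deg_ne_zero a)
    (h.transfer_mem_homog hs (var_mem_homog a)))
  range u := by
    obtain ⟨v, hv⟩ := h.exists_body_transfer hs u
    simp only [hv, body_const]
    exact v.2

theorem pullGlobal_hom_transfer (f : D₂.Sec p D₂.U) :
    (h.isSubstData_transfer hs).hom.pullGlobal f = h.transfer hs f := by
  rw [IsSubstData.pullGlobal_hom]
  refine DFunLike.congr_fun (algHom_ext_of_coord (fun μ => IsSubstData.substHom_coord _ μ)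
    (fun a => IsSubstData.substHom_var _ a) (fun u => ?_) fun a => ?_) f
  · simpa only [IsSubstData.substHom_coord] using (h.isSubstData_transfer hs).range u
  · rw [IsSubstData.substHom_var]
    exact (h.isSubstData_transfer hs).var_filt a

end IsCoordinateSystem

end GDomain

end IGraded

end

/-! ### The Global Chart Theorem. -/

theorem mainTheorem2 {I : Type*} [NonUnitalCommSemiring I] [IsCancelAdd I] [Countable I]
    (p : I →+ ZMod 2) (hp : p ≠ 0) (D₁ D₂ : IGraded.GDomain I)
    (x : Fin D₂.n → D₂.Sec p D₂.U) (θ : Fin D₂.N → D₂.Sec p D₂.U)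
    (hxθ : D₂.IsCoordinateSystem p x θ) :
    -- the images of the coordinates under a morphism
    (∀ φ : IGraded.GDomain.Hom p D₁ D₂,
      (∀ μ, φ.pullGlobal (x μ) ∈ IGraded.GSeries.homog p D₁.deg (IGraded.Cinf D₁.U) 0) ∧
      (∀ a, φ.pullGlobal (θ a) ∈
        IGraded.GSeries.homog p D₁.deg (IGraded.Cinf D₁.U) (D₂.deg a)) ∧
      ∀ u : D₁.U, IGraded.GDomain.bodyMap (fun μ => φ.pullGlobal (x μ)) u ∈ hxθ.image) ∧
    -- every section has a unique expansion in the coordinates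
    (∀ f : D₂.Sec p D₂.U,
      ∃! c : {β : Fin D₂.N →₀ ℕ // IGraded.Adm p D₂.deg β} → IGraded.Cinf hxθ.image,
        IGraded.GDomain.IsExpansion c x (fun u => Set.mem_range_self u) θ f) ∧
    -- all such data come from exactly one morphism, given by substitution into the expansion
    ∀ (y : Fin D₂.n → D₁.Sec p D₁.U) (η : Fin D₂.N → D₁.Sec p D₁.U),
      (∀ μ, y μ ∈ IGraded.GSeries.homog p D₁.deg (IGraded.Cinf D₁.U) 0) →
      (∀ a, η a ∈ IGraded.GSeries.homog p D₁.deg (IGraded.Cinf D₁.U) (D₂.deg a)) →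
      ∀ hy : ∀ u : D₁.U, IGraded.GDomain.bodyMap y u ∈ hxθ.image,
        ∃ φ : IGraded.GDomain.Hom p D₁ D₂,
          ((∀ μ, φ.pullGlobal (x μ) = y μ) ∧ ∀ a, φ.pullGlobal (θ a) = η a) ∧
          (∀ (f : D₂.Sec p D₂.U)
            (c : {β : Fin D₂.N →₀ ℕ // IGraded.Adm p D₂.deg β} → IGraded.Cinf hxθ.image),
            IGraded.GDomain.IsExpansion c x (fun u => Set.mem_range_self u) θ f →
              IGraded.GDomain.IsExpansion c y hy η (φ.pullGlobal f)) ∧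
          ∀ ψ : IGraded.GDomain.Hom p D₁ D₂,
            (∀ μ, ψ.pullGlobal (x μ) = y μ) → (∀ a, ψ.pullGlobal (θ a) = η a) → ψ = φ := by
  have hsx := hxθ.isSubstData
  refine ⟨fun φ => ⟨fun μ => φ.pullGlobal_mem_homog (hxθ.x_mem μ),
    fun a => φ.pullGlobal_mem_homog (hxθ.θ_mem a), hxθ.bodyMap_pullGlobal_mem φ⟩,
    fun f => ?_, fun y η hy0 hη hy => ?_⟩
  · obtain ⟨c, hc⟩ := hxθ.substHom_surjective f
    refine ⟨c, (IGraded.GDomain.isExpansion_iff hsx _ c f).2 hc, fun c' hc' => ?_⟩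
    have h' := (IGraded.GDomain.isExpansion_iff hsx _ c' f).1 hc'
    exact hxθ.substHom_injective (h'.trans hc.symm)
  -- The degree of η_a is non-zero, so η_a has no constant term; this is what makes the infinite
  -- sums in η finite in each coefficient.
  · have hs : IGraded.GSeries.IsSubstData hxθ.image D₂.deg y η :=
      ⟨hy0, hη, fun a => IGraded.GSeries.filt_one.2
        (IGraded.GSeries.body_eq_zero_of_mem_homog (D₂.deg_ne_zero a) (hη a)), hy⟩
    have hx : ∀ μ, (hxθ.isSubstData_transfer hs).hom.pullGlobal (x μ) = y μ := fun μ => by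
      rw [hxθ.pullGlobal_hom_transfer, ← hsx.substHom_coord μ, hxθ.transfer_substHom,
        hs.substHom_coord]
    have hθ : ∀ a, (hxθ.isSubstData_transfer hs).hom.pullGlobal (θ a) = η a := fun a => by
      rw [hxθ.pullGlobal_hom_transfer, ← hsx.substHom_var a, hxθ.transfer_substHom,
        hs.substHom_var]
    refine ⟨(hxθ.isSubstData_transfer hs).hom, ⟨hx, hθ⟩, fun f c hc => ?_, fun ψ hψx hψθ =>
      hxθ.hom_ext (fun μ => (hψx μ).trans (hx μ).symm) fun a => (hψθ a).trans (hθ a).symm⟩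
    have hf := (IGraded.GDomain.isExpansion_iff hsx _ c f).1 hc
    refine (IGraded.GDomain.isExpansion_iff hs hy c _).2 ?_
    rw [hxθ.pullGlobal_hom_transfer, ← hf]
    exact (hxθ.transfer_substHom hs c).symm
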